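/- For an integer $k\ge 1$ let $\Delta_k$ be the oriented ideal triangle in the upper half-plane $\mathbb{H}^2$ with vertices $\infty,-1,0$ and marked points $-1+i$, $\frac{-k+i\sqrt{k}}{k+1}$, $i\sqrt{k}$ on its sides $[\infty,-1]$, $[-1,0]$, $[0,\infty]$, which are said to have type $1$, $\frac1k$, $k$ respectively. A tile of type $k$ is the image of $\Delta_k$, with its marked points and side types, under an orientation-preserving isometry of $\mathbb{H}^2$. Two tiles may be glued along sides of the same type, identifying the marked points. An ideal polygon obtained by successively gluing finitely many tiles in this way is called a jigsaw, and the jigsaw group $\Gamma_J\le PSL(2,\mathbb{R})$ of a jigsaw $J$ is the group generated by the rotations by the angle $\pi$ about the marked points of the exterior sides of $J$. The cusps of a subgroup of $PSL(2,\mathbb{R})$ are the points of $\mathbb{R}\cup\{\infty\}$ fixed by its parabolic elements. For integers $m\ge 1$ and $n\ge 1$ let $J_{m,n}$ be the jigsaw formed by the tile $\Delta_1$, followed by $m-1$ tiles of type $1$ glued successively to its left and $n$ tiles of type $4$ glued successively to its right, so that all tiles of $J_{m,n}$ share $\infty$ as a common vertex. **Proposition.** For all integers $m\ge 1$ and $n\ge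 1$, the set of cusps of the jigsaw group $\Gamma$ of $J_{m,n}$ is exactly $\mathbb{Q}\cup\{\infty\}$. -/

import Mathlib

open scoped MatrixGroups UpperHalfPlane OnePoint

noncomputable section

namespace Jigsaw

/-! ### Orientation-preserving isometries of the hyperbolic plane -/

/-- The matrix in `SL(2, ℝ)` representing the rotation by the angle `π` about `z = x + iy`, namely
`(1/y) * (x, -(x ^ 2 + y ^ 2); 1, -x)`. -/
def rotMatrix (z : ℍ) : SL(2, ℝ) :=
  ⟨!![z.re / z.im, -(z.re ^ 2 + z.im ^ 2) / z.im; 1 / z.im, -z.re / z.im], by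
    have h := z.im_ne_zero
    rw [Matrix.det_fin_two_of]
    field_simp
    ring⟩

/-- The rotation by the angle `π` about a point of the hyperbolic plane, in `PSL(2, ℝ)`. -/
def rotation (z : ℍ) : PSL(2, ℝ) := QuotientGroup.mk (rotMatrix z)

/-- The horizontal translation `z ↦ z + t`. -/
def translation (t : ℝ) : SL(2, ℝ) := ⟨!![1, t; 0, 1], by simp⟩

/-- The action of `SL(2, ℝ)` by fractional linear transformations on the boundary `ℝ ∪ {∞}`. -/
def onBoundary (g : SL(2, ℝ)) (c : OnePoint ℝ) : OnePoint ℝ :=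
  Matrix.SpecialLinearGroup.toGL g • c

/-! ### Sides, tiles -/

/-- A side of an oriented ideal triangle: a geodesic from the ideal point `src` to the ideal point
`tgt`, together with a type and a marked point. -/
@[ext] structure Side where
  src : OnePoint ℝ
  tgt : OnePoint ℝ
  type : ℚ
  mark : ℍ

/-- The same side (same type, same marked point) with the opposite orientation. -/
def Side.rev (s : Side) : Side := ⟨s.tgt, s.src, s.type, s.mark⟩

/-- The image of a side under an isometry. -/
def Side.map (g : SL(2, ℝ)) (s : Side) : Side :=
  ⟨onBoundary g s.src, onBoundary g s.tgt, s.type, g • s.mark⟩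

/-- An oriented ideal triangle with marked points, given by its three cyclically ordered sides. -/
@[ext] structure Tile where
  side : Fin 3 → Side

/-- The image of a tile under an isometry, keeping track of types and marked points. -/
def Tile.map (g : SL(2, ℝ)) (T : Tile) : Tile := ⟨fun i => (T.side i).map g⟩

/-- The ideal triangle `Δ_n` with vertices `∞, -1, 0`; its sides `[∞, -1]`, `[-1, 0]`, `[0, ∞]`
have types `1`, `1/n`, `n` and marked points `-1 + i`, `(-n + i√n)/(n + 1)`, `i√n`. -/
def Delta (n : ℕ+) : Tile where
  side := ![
    ⟨∞, ((-1 : ℝ) : OnePoint ℝ), 1, ⟨⟨-1, 1⟩, one_pos⟩⟩,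
    ⟨((-1 : ℝ) : OnePoint ℝ), ((0 : ℝ) : OnePoint ℝ), 1 / (n : ℚ),
      ⟨⟨-(n : ℝ) / ((n : ℝ) + 1), √(n : ℝ) / ((n : ℝ) + 1)⟩, by
        have : (0 : ℝ) < (n : ℝ) := by exact_mod_cast n.pos
        show 0 < √(n : ℝ) / ((n : ℝ) + 1)
        positivity⟩⟩,
    ⟨((0 : ℝ) : OnePoint ℝ), ∞, (n : ℚ),
      ⟨⟨0, √(n : ℝ)⟩, by
        have : (0 : ℝ) < (n : ℝ) := by exact_mod_cast n.pos
        show 0 < √(n : ℝ)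
        positivity⟩⟩]

/-- A tile of type `n` is an image of `Δ_n` under an orientation-preserving isometry. -/
def Tile.IsOfType (n : ℕ+) (T : Tile) : Prop := ∃ g : SL(2, ℝ), T = (Delta n).map g

/-! ### Jigsaws and their groups -/

/-- The exterior sides of a collection of tiles: the sides along which no other tile is glued. -/
def exteriorSides (J : Set Tile) : Set Side :=
  {s | (∃ T ∈ J, ∃ i, T.side i = s) ∧ ∀ T ∈ J, ∀ i, T.side i ≠ s.rev}

/-- The collections of tiles obtained from one tile by successively gluing finitely many tiles along
matching sides: a new tile is glued to an exterior side `s` along one of its own sides, which must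
have the same endpoints, the same type and the same marked point as `s`. As tiles lie to the left of
their oriented sides, the glued sides have opposite orientations. -/
inductive IsGluing : Set Tile → Prop
  | single {n : ℕ+} {T : Tile} (hT : T.IsOfType n) : IsGluing {T}
  | glue {J : Set Tile} {n : ℕ+} {T : Tile} {s : Side} (hJ : IsGluing J)
      (hs : s ∈ exteriorSides J) (hT : T.IsOfType n) (hTs : ∃ i, T.side i = s.rev) :
      IsGluing (insert T J)

end Jigsaw

open Jigsaw in
/-- A jigsaw: an ideal polygon triangulated by finitely many tiles glued along matching sides,
normalized so that one of the tiles is some `Δ_n`, with vertices `∞, -1, 0`. -/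
structure Jigsaw where
  tiles : Set Tile
  isGluing : IsGluing tiles
  normalized : ∃ n, Delta n ∈ tiles

namespace Jigsaw

/-- The jigsaw group: the subgroup of `PSL(2, ℝ)` generated by the `π`-rotations about the marked
points of the exterior sides. -/
def group (J : Jigsaw) : Subgroup PSL(2, ℝ) :=
  Subgroup.closure {r | ∃ s ∈ exteriorSides J.tiles, r = rotation s.mark}

/-- The cusps of a subgroup of `PSL(2, ℝ)`: the points of `ℝ ∪ {∞}` fixed by one of its parabolic
elements, that is, the cusps of its preimage in `SL(2, ℝ)`. -/
def cuspSet (Γ : Subgroup PSL(2, ℝ)) : Set (OnePoint ℝ) :=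
  {c | IsCusp c ((Γ.comap (QuotientGroup.mk' (Subgroup.center SL(2, ℝ)))).map
    Matrix.SpecialLinearGroup.toGL)}

/-! ### The jigsaw `J_{m,n}` -/

/-- The tiles of type 1 of `J_{m,n}`: starting from `Δ_1`, each one is glued to the left of the
previous one, so that the `i`-th one is the translate of `Δ_1` by `-i`. -/
def leftTile (i : ℕ) : Tile := (Delta 1).map (translation (-(i : ℝ)))

/-- The number of the right-hand vertical side of the `k`-th tile of type 4: `2, 1, 0, 2, 1, 0, …`.
These sides have types `4, 1/4, 1, 4, 1/4, 1, …`. -/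
def rightIndex (k : ℕ) : Fin 3 := Fin.ofNat 3 (2 * k + 2)

/-- The tiles of type 4 of `J_{m,n}`. The first one is `Δ_4 + 1`, with vertices `∞, 0, 1`; it is
glued along its side `[∞, 0]` of type 1 to the side `[0, ∞]` of `Δ_1`. Each one is then glued to the
right-hand vertical side of the previous one; two tiles of the same type glued along a side are
exchanged by the `π`-rotation about the marked point of that side. -/
def rightTile : ℕ → Tile
  | 0 => (Delta 4).map (translation 1)
  | k + 1 => (rightTile k).map (rotMatrix ((rightTile k).side (rightIndex k)).mark)

/-- The tiles of `J_{m,n}`: `m` tiles of type 1 and `n` tiles of type 4. -/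
def tilesOf (m n : ℕ) : Set Tile :=
  {T | (∃ i < m, T = leftTile i) ∨ ∃ k < n, T = rightTile k}

/-! ### The collection of tiles of `J_{m,n}` is a jigsaw -/

theorem onBoundary_mul (g h : SL(2, ℝ)) (c : OnePoint ℝ) :
    onBoundary (g * h) c = onBoundary g (onBoundary h c) := by
  simp [onBoundary, mul_smul]

theorem onBoundary_infty (g : SL(2, ℝ)) :
    onBoundary g ∞ = if g 1 0 = 0 then ∞ else ((g 0 0 / g 1 0 : ℝ) : OnePoint ℝ) := by
  exact OnePoint.smul_infty_eq_ite _

theorem onBoundary_coe (g : SL(2, ℝ)) (x : ℝ) :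
    onBoundary g x = if g 1 0 * x + g 1 1 = 0 then ∞ else
      (((g 0 0 * x + g 0 1) / (g 1 0 * x + g 1 1) : ℝ) : OnePoint ℝ) := by
  exact OnePoint.smul_some_eq_ite

theorem translation_infty (t : ℝ) : onBoundary (translation t) ∞ = ∞ := by
  rw [onBoundary_infty, if_pos (by simp [translation])]

theorem translation_coe (t x : ℝ) :
    onBoundary (translation t) (x : OnePoint ℝ) = ((x + t : ℝ) : OnePoint ℝ) := by
  rw [onBoundary_coe, if_neg (by simp [translation])]
  simp [translation]

theorem rotMatrix_infty (z : ℍ) : onBoundary (rotMatrix z) ∞ = (z.re : OnePoint ℝ) := by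
  have h := z.im_ne_zero
  rw [onBoundary_infty, if_neg (by simp [rotMatrix, h])]
  congr 1
  simp [rotMatrix]
  field_simp

theorem rotMatrix_coe (z : ℍ) (x : ℝ) : onBoundary (rotMatrix z) (x : OnePoint ℝ) =
    if x = z.re then ∞ else ((z.re - z.im ^ 2 / (x - z.re) : ℝ) : OnePoint ℝ) := by
  have h := z.im_ne_zero
  rw [onBoundary_coe]
  have e : (rotMatrix z) 1 0 * x + (rotMatrix z) 1 1 = (x - z.re) / z.im := by
    simp [rotMatrix]; field_simp; ring
  have e' : (rotMatrix z) 0 0 * x + (rotMatrix z) 0 1 =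
      (z.re * (x - z.re) - z.im ^ 2) / z.im := by
    simp [rotMatrix]; field_simp; ring
  rw [e, e']
  by_cases hx : x = z.re
  · simp [hx]
  · have : x - z.re ≠ 0 := sub_ne_zero.2 hx
    rw [if_neg (by simp [this, h]), if_neg hx]
    congr 1
    field_simp

/-- The rotation fixes its centre. -/
theorem rotMatrix_smul_self (z : ℍ) : rotMatrix z • z = z := by
  apply UpperHalfPlane.ext
  rw [UpperHalfPlane.coe_specialLinearGroup_apply]
  have h : (z.im : ℂ) ≠ 0 := by exact_mod_cast z.im_ne_zero
  have e : (z : ℂ) = z.re + z.im * Complex.I := (Complex.re_add_im _).symm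
  simp only [rotMatrix, Matrix.of_apply, Matrix.cons_val', Matrix.cons_val_zero,
    Matrix.cons_val_one, Algebra.algebraMap_self_apply, Matrix.cons_val_fin_one, e]
  have hd : ((1 / z.im : ℝ) : ℂ) * (z.re + z.im * Complex.I) + ((-z.re / z.im : ℝ) : ℂ)
      = Complex.I := by
    push_cast; field_simp; ring
  rw [hd, div_eq_iff Complex.I_ne_zero]
  push_cast
  field_simp
  linear_combination (-(z.im : ℂ) ^ 2) * Complex.I_sq

/-- The rotation is an involution in `PSL(2, ℝ)`. -/
theorem rotMatrix_mul_self (z : ℍ) : rotMatrix z * rotMatrix z = -1 := by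
  have h := z.im_ne_zero
  apply Subtype.ext
  ext i j
  rw [Matrix.SpecialLinearGroup.coe_mul, Matrix.mul_apply, Fin.sum_univ_two]
  fin_cases i <;> fin_cases j <;>
    simp [rotMatrix] <;> field_simp <;> ring

theorem rotMatrix_smul (g : SL(2, ℝ)) (z : ℍ) : rotMatrix (g • z) * g = g * rotMatrix z := by
  have h := z.im_ne_zero
  have hdet : g 0 0 * g 1 1 - g 0 1 * g 1 0 = 1 := by
    rw [← Matrix.det_fin_two]; exact g.2
  have hN : (g 1 0 * z.re + g 1 1) ^ 2 + (g 1 0 * z.im) ^ 2 ≠ 0 := by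
    intro h0
    have h1 : g 1 0 * z.im = 0 := by nlinarith [sq_nonneg (g 1 0 * z.re + g 1 1), sq_nonneg (g 1 0 * z.im)]
    have h2 : g 1 0 = 0 := by simpa [h] using h1
    have h3 : g 1 1 = 0 := by simpa [h2] using h0
    simp [h2, h3] at hdet
  have hc : ((g • z : ℍ) : ℂ) = (g 0 0 * z + g 0 1) / (g 1 0 * z + g 1 1) :=
    UpperHalfPlane.coe_specialLinearGroup_apply g z
  have hden : (g 1 0 : ℂ) * z + g 1 1 ≠ 0 := by
    intro h0
    apply hN
    have h1 := congrArg Complex.re h0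
    have h2 := congrArg Complex.im h0
    simp at h1 h2
    rw [h1]
    rcases h2 with h2 | h2
    · simp [h2]
    · exact absurd h2 h
  rw [eq_div_iff hden] at hc
  have h1 := congrArg Complex.re hc
  have h2 := congrArg Complex.im hc
  simp at h1 h2
  have hv : (g • z).im ≠ 0 := (g • z).im_ne_zero
  apply Subtype.ext
  ext i j
  rw [Matrix.SpecialLinearGroup.coe_mul, Matrix.mul_apply, Fin.sum_univ_two,
    Matrix.SpecialLinearGroup.coe_mul, Matrix.mul_apply, Fin.sum_univ_two]
  fin_cases i <;> fin_cases j
  · simp [rotMatrix]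
    field_simp
    linear_combination (-(g • z).re) * h2 + (g • z).im * h1
  · simp [rotMatrix]
    field_simp
    linear_combination (-(g • z).re) * (z.im * h1 - z.re * h2) - (g • z).im * (z.re * h1 + z.im * h2)
  · simp [rotMatrix]
    field_simp
    linear_combination -h2
  · simp [rotMatrix]
    field_simp
    linear_combination z.re * h2 - z.im * h1

/-- The marked point lies on the geodesic: the rotation about it reverses the side. -/
def Side.Good (s : Side) : Prop := s.map (rotMatrix s.mark) = s.rev

theorem Side.map_map (g h : SL(2, ℝ)) (s : Side) : (s.map h).map g = s.map (g * h) := by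
  simp [Side.map, onBoundary_mul, mul_smul]

theorem Side.Good.map {s : Side} (h : s.Good) (g : SL(2, ℝ)) : (s.map g).Good := by
  have h' := congrArg (Side.map g) h
  unfold Side.Good
  rw [Side.map_map]
  change s.map (rotMatrix (g • s.mark) * g) = _
  rw [rotMatrix_smul, ← Side.map_map]
  exact h'

theorem Side.good_of {s : Side} (h1 : onBoundary (rotMatrix s.mark) s.src = s.tgt)
    (h2 : onBoundary (rotMatrix s.mark) s.tgt = s.src) : s.Good := by
  simp [Side.Good, Side.map, Side.rev, h1, h2, rotMatrix_smul_self]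

theorem Delta_good (n : ℕ+) (i : Fin 3) : ((Delta n).side i).Good := by
  have hn : (0 : ℝ) < (n : ℝ) := by exact_mod_cast n.pos
  fin_cases i
  · apply Side.good_of
    · exact rotMatrix_infty _
    · exact (rotMatrix_coe _ _).trans (if_pos rfl)
  · have hs : √(n : ℝ) ^ 2 = n := Real.sq_sqrt hn.le
    apply Side.good_of
    · refine (rotMatrix_coe _ _).trans ((if_neg ?_).trans ?_)
      · change ¬ ((-1 : ℝ) = -(n : ℝ) / ((n : ℝ) + 1))
        field_simp
        linarith
      · change ((-(n : ℝ) / ((n : ℝ) + 1) - (√(n : ℝ) / ((n : ℝ) + 1)) ^ 2 /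
          (-1 - -(n : ℝ) / ((n : ℝ) + 1)) : ℝ) : OnePoint ℝ) = ((0 : ℝ) : OnePoint ℝ)
        congr 1
        have : (-1 - -(n : ℝ) / ((n : ℝ) + 1)) = - 1 / ((n : ℝ) + 1) := by field_simp; ring
        rw [this, div_pow, hs]
        field_simp
        ring
    · refine (rotMatrix_coe _ _).trans ((if_neg ?_).trans ?_)
      · change ¬ ((0 : ℝ) = -(n : ℝ) / ((n : ℝ) + 1))
        field_simp
        linarith
      · change ((-(n : ℝ) / ((n : ℝ) + 1) - (√(n : ℝ) / ((n : ℝ) + 1)) ^ 2 /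
          (0 - -(n : ℝ) / ((n : ℝ) + 1)) : ℝ) : OnePoint ℝ) = ((-1 : ℝ) : OnePoint ℝ)
        congr 1
        rw [div_pow, hs]
        field_simp
        ring
  · apply Side.good_of
    · exact (rotMatrix_coe _ _).trans (if_pos rfl)
    · exact rotMatrix_infty _

theorem Tile.map_map (g h : SL(2, ℝ)) (T : Tile) : (T.map h).map g = T.map (g * h) := by
  simp [Tile.map, Side.map_map]

theorem Tile.IsOfType.map {n : ℕ+} {T : Tile} (h : T.IsOfType n) (g : SL(2, ℝ)) :
    (T.map g).IsOfType n := by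
  obtain ⟨k, rfl⟩ := h
  exact ⟨g * k, Tile.map_map _ _ _⟩

theorem Tile.IsOfType.good {n : ℕ+} {T : Tile} (h : T.IsOfType n) (i : Fin 3) :
    (T.side i).Good := by
  obtain ⟨k, rfl⟩ := h
  exact (Delta_good n i).map k

theorem rightTile_isOfType (k : ℕ) : (rightTile k).IsOfType 4 := by
  induction k with
  | zero => exact ⟨_, rfl⟩
  | succ k ih => exact ih.map _

theorem rightTile_glued (k : ℕ) :
    (rightTile (k + 1)).side (rightIndex k) = ((rightTile k).side (rightIndex k)).rev :=
  (rightTile_isOfType k).good _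

theorem rightIndex_succ (k : ℕ) : rightIndex (k + 1) = rightIndex k + 2 := by
  apply Fin.ext
  simp [rightIndex, Fin.ofNat, Fin.val_add]
  omega

/-- The endpoints of the sides of the tiles on the right. -/
theorem rightTile_ends (k : ℕ) : ∃ a b : ℝ, 0 ≤ a ∧ a < b ∧
    ((rightTile k).side (rightIndex k)).src = b ∧
    ((rightTile k).side (rightIndex k)).tgt = ∞ ∧
    ((rightTile k).side (rightIndex k + 1)).src = ∞ ∧
    ((rightTile k).side (rightIndex k + 1)).tgt = a ∧
    ((rightTile k).side (rightIndex k + 2)).src = a ∧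
    ((rightTile k).side (rightIndex k + 2)).tgt = b := by
  induction k with
  | zero =>
    refine ⟨0, 1, le_rfl, one_pos, ?_, ?_, ?_, ?_, ?_, ?_⟩
    · exact (translation_coe 1 0).trans (by simp)
    · exact translation_infty 1
    · exact translation_infty 1
    · exact (translation_coe 1 (-1)).trans (by simp)
    · exact (translation_coe 1 (-1)).trans (by simp)
    · exact (translation_coe 1 0).trans (by simp)
  | succ k ih =>
    obtain ⟨a, b, ha, hab, h1, h2, h3, h4, h5, h6⟩ := ih
    have hg := rightTile_glued k
    have hgood : ((rightTile k).side (rightIndex k)).Good := (rightTile_isOfType k).good _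
    set z := ((rightTile k).side (rightIndex k)).mark with hz
    have hre : z.re = b := by
      have := congrArg Side.tgt hgood
      change onBoundary (rotMatrix z) ((rightTile k).side (rightIndex k)).tgt =
        ((rightTile k).side (rightIndex k)).src at this
      rw [h1, h2, rotMatrix_infty] at this
      exact OnePoint.coe_injective this
    have e1 : rightIndex k + 2 + 1 = rightIndex k := by generalize rightIndex k = r; revert r; decide
    have e2 : rightIndex k + 2 + 2 = rightIndex k + 1 := by
      generalize rightIndex k = r; revert r; decide
    have hb : onBoundary (rotMatrix z) (b : OnePoint ℝ) = ∞ := by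
      rw [rotMatrix_coe, if_pos hre.symm]
    have hc : onBoundary (rotMatrix z) (a : OnePoint ℝ) =
        ((z.re - z.im ^ 2 / (a - z.re) : ℝ) : OnePoint ℝ) := by
      rw [rotMatrix_coe, if_neg (by rw [hre]; exact hab.ne)]
    have hi : onBoundary (rotMatrix z) ∞ = (b : OnePoint ℝ) := by rw [rotMatrix_infty, hre]
    refine ⟨b, z.re - z.im ^ 2 / (a - z.re), by linarith, ?_, ?_⟩
    · have : z.im ^ 2 / (a - z.re) < 0 :=
        div_neg_of_pos_of_neg (pow_pos z.im_pos 2) (by linarith)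
      linarith
    rw [rightIndex_succ, e1, e2, hg]
    refine ⟨?_, ?_, h2, h1, ?_, ?_⟩
    · change onBoundary (rotMatrix z) ((rightTile k).side (rightIndex k + 2)).src = _
      rw [h5, hc]
    · change onBoundary (rotMatrix z) ((rightTile k).side (rightIndex k + 2)).tgt = _
      rw [h6, hb]
    · change onBoundary (rotMatrix z) ((rightTile k).side (rightIndex k + 1)).src = _
      rw [h3, hi]
    · change onBoundary (rotMatrix z) ((rightTile k).side (rightIndex k + 1)).tgt = _
      rw [h4, hc]

theorem exists_rightVertex : ∃ v : ℕ → ℝ, StrictMono v ∧ 0 ≤ v 0 ∧ ∀ k,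
    ((rightTile k).side (rightIndex k)).src = v (k + 1) ∧
    ((rightTile k).side (rightIndex k)).tgt = ∞ ∧
    ∀ i, ((rightTile k).side i).src = ∞ → ((rightTile k).side i).tgt = v k := by
  choose a b ha hab h1 h2 h3 h4 h5 h6 using rightTile_ends
  have hs (k : ℕ) : a (k + 1) = b k := by
    have h := congrArg Side.tgt (rightTile_glued k)
    have e1 : rightIndex k = rightIndex (k + 1) + 1 := by
      rw [rightIndex_succ]; generalize rightIndex k = r; revert r; decide
    rw [show ((rightTile k).side (rightIndex k)).rev.tgt =
      ((rightTile k).side (rightIndex k)).src from rfl, h1, e1, h4] at h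
    exact OnePoint.coe_injective h
  refine ⟨a, strictMono_nat_of_lt_succ fun k => by rw [hs]; exact hab k, ha 0, fun k =>
    ⟨by rw [hs, h1], h2 k, fun i hi => ?_⟩⟩
  have hi' : i = rightIndex k ∨ i = rightIndex k + 1 ∨ i = rightIndex k + 2 := by
    clear hi
    generalize rightIndex k = r; revert r i; decide
  rcases hi' with rfl | rfl | rfl
  · rw [h1] at hi; exact absurd hi (OnePoint.coe_ne_infty _)
  · exact h4 k
  · rw [h5] at hi; exact absurd hi (OnePoint.coe_ne_infty _)

theorem leftTile_ends (i : ℕ) :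
    ((leftTile i).side 0).src = ∞ ∧ ((leftTile i).side 0).tgt = ((-1 + -(i : ℝ) : ℝ) : OnePoint ℝ) ∧
    ((leftTile i).side 1).src = ((-1 + -(i : ℝ) : ℝ) : OnePoint ℝ) ∧
    ((leftTile i).side 1).tgt = ((0 + -(i : ℝ) : ℝ) : OnePoint ℝ) ∧
    ((leftTile i).side 2).src = ((0 + -(i : ℝ) : ℝ) : OnePoint ℝ) ∧
    ((leftTile i).side 2).tgt = ∞ :=
  ⟨translation_infty _, translation_coe _ _, translation_coe _ _, translation_coe _ _,
    translation_coe _ _, translation_infty _⟩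

theorem translation_smul (t : ℝ) (z : ℍ) : ((translation t • z : ℍ) : ℂ) = z + t := by
  rw [UpperHalfPlane.coe_specialLinearGroup_apply]
  simp [translation]

theorem leftTile_glued (i : ℕ) : (leftTile (i + 1)).side 2 = ((leftTile i).side 0).rev := by
  obtain ⟨h1, h2, -⟩ := leftTile_ends i
  obtain ⟨-, -, -, -, h5, h6⟩ := leftTile_ends (i + 1)
  apply Side.ext
  · refine h5.trans (Eq.trans ?_ h2.symm)
    congr 1
    push_cast
    ring
  · exact h6.trans h1.symm
  · simp [leftTile, Tile.map, Side.map, Delta, Side.rev]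
  · apply UpperHalfPlane.ext
    refine (translation_smul _ _).trans (Eq.trans ?_ (translation_smul _ _).symm)
    apply Complex.ext
    · simp [Delta]
    · simp [Delta]

theorem rightTile_zero_glued : (rightTile 0).side 0 = ((leftTile 0).side 2).rev := by
  obtain ⟨-, -, -, -, h5, h6⟩ := leftTile_ends 0
  apply Side.ext
  · exact (translation_infty _).trans h6.symm
  · refine (translation_coe _ _).trans (Eq.trans ?_ h5.symm)
    congr 1
    simp
  · simp [leftTile, rightTile, Tile.map, Side.map, Delta, Side.rev]
  · apply UpperHalfPlane.ext
    refine (translation_smul _ _).trans (Eq.trans ?_ (translation_smul _ _).symm)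
    apply Complex.ext
    · simp [Delta]
    · simp [Delta]

theorem isGluing_left (m : ℕ) : IsGluing (tilesOf (m + 1) 0) := by
  induction m with
  | zero =>
    have : tilesOf (0 + 1) 0 = {leftTile 0} := by
      ext T; simp [tilesOf]
    rw [this]
    exact .single ⟨_, rfl⟩
  | succ m ih =>
    have : tilesOf (m + 1 + 1) 0 = insert (leftTile (m + 1)) (tilesOf (m + 1) 0) := by
      ext T
      simp only [tilesOf, Nat.not_lt_zero, false_and, exists_false, or_false, Set.mem_insert_iff,
        Set.mem_ofPred_eq]
      constructor
      · rintro ⟨i, hi, rfl⟩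
        rcases (Nat.lt_succ_iff_lt_or_eq.1 hi) with h | rfl
        · exact Or.inr ⟨i, h, rfl⟩
        · exact Or.inl rfl
      · rintro (rfl | ⟨i, hi, rfl⟩)
        · exact ⟨m + 1, by omega, rfl⟩
        · exact ⟨i, by omega, rfl⟩
    rw [this]
    refine .glue (n := 1) (s := (leftTile m).side 0) ih ⟨⟨leftTile m, Or.inl ⟨m, by omega, rfl⟩,
      0, rfl⟩, ?_⟩ ⟨_, rfl⟩ ⟨2, leftTile_glued m⟩
    rintro T (⟨j, hj, rfl⟩ | ⟨k, hk, -⟩) i h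
    swap
    · omega
    obtain ⟨h1, h2, -⟩ := leftTile_ends m
    obtain ⟨g1, g2, g3, g4, g5, g6⟩ := leftTile_ends j
    have hs := congrArg Side.src h
    have ht := congrArg Side.tgt h
    simp only [Side.rev, h1, h2] at hs ht
    fin_cases i
    · exact OnePoint.infty_ne_coe _ (g1.symm.trans hs)
    · exact OnePoint.coe_ne_infty _ (g4.symm.trans ht)
    · have := OnePoint.coe_injective (g5.symm.trans hs)
      have : (j : ℝ) = m + 1 := by linarith
      have : j = m + 1 := by exact_mod_cast this
      omega

theorem isGluing_tilesOf (m n : ℕ) : IsGluing (tilesOf (m + 1) n) := by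
  induction n with
  | zero => exact isGluing_left m
  | succ n ih =>
    obtain ⟨v, hv, hv0, hr⟩ := exists_rightVertex
    have : tilesOf (m + 1) (n + 1) = insert (rightTile n) (tilesOf (m + 1) n) := by
      ext T
      simp only [tilesOf, Set.mem_insert_iff, Set.mem_ofPred_eq]
      constructor
      · rintro (h | ⟨i, hi, rfl⟩)
        · exact Or.inr (Or.inl h)
        rcases (Nat.lt_succ_iff_lt_or_eq.1 hi) with h | rfl
        · exact Or.inr (Or.inr ⟨i, h, rfl⟩)
        · exact Or.inl rfl
      · rintro (rfl | h | ⟨i, hi, rfl⟩)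
        · exact Or.inr ⟨n, by omega, rfl⟩
        · exact Or.inl h
        · exact Or.inr ⟨i, by omega, rfl⟩
    rw [this]
    have key (x : ℝ) (hx : 0 ≤ x) (hx' : ∀ k < n, v k ≠ x) (T : Tile) (hT : T ∈ tilesOf (m + 1) n)
        (i : Fin 3) (hs : (T.side i).src = ∞) (ht : (T.side i).tgt = x) : False := by
      rcases hT with ⟨j, hj, rfl⟩ | ⟨k, hk, rfl⟩
      · obtain ⟨g1, g2, g3, g4, g5, g6⟩ := leftTile_ends j
        fin_cases i
        · have := OnePoint.coe_injective (g2.symm.trans ht)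
          have hj0 : (0 : ℝ) ≤ j := j.cast_nonneg
          linarith
        · exact OnePoint.coe_ne_infty _ (g3.symm.trans hs)
        · exact OnePoint.coe_ne_infty _ (g5.symm.trans hs)
      · exact hx' k hk (OnePoint.coe_injective (((hr k).2.2 i hs).symm.trans ht))
    rcases n with _ | n
    · obtain ⟨-, -, -, -, h5, h6⟩ := leftTile_ends 0
      refine .glue (n := 4) (s := (leftTile 0).side 2) ih ⟨⟨leftTile 0, Or.inl ⟨0, by omega, rfl⟩,
        2, rfl⟩, fun T hT i h => ?_⟩ (rightTile_isOfType 0) ⟨0, rightTile_zero_glued⟩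
      refine key 0 le_rfl (by omega) T hT i ((congrArg Side.src h).trans h6)
        ((congrArg Side.tgt h).trans (h5.trans ?_))
      simp
    · refine .glue (n := 4) (s := (rightTile n).side (rightIndex n)) ih
        ⟨⟨rightTile n, Or.inr ⟨n, by omega, rfl⟩, _, rfl⟩, fun T hT i h => ?_⟩
        (rightTile_isOfType _) ⟨_, rightTile_glued n⟩
      refine key (v (n + 1)) (hv0.trans (hv.monotone (by omega))) (fun k hk => (hv hk).ne) T hT i
        ((congrArg Side.src h).trans (hr n).2.1) ((congrArg Side.tgt h).trans (hr n).1)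

theorem leftTile_zero : leftTile 0 = Delta 1 := by
  have h : translation (-((0 : ℕ) : ℝ)) = 1 := by
    apply Subtype.ext
    ext i j
    fin_cases i <;> fin_cases j <;> simp [translation]
  rw [leftTile, h]
  simp [Tile.map, Side.map, onBoundary]

/-- The jigsaw `J_{m,n}`: the tile `Δ_1`, followed by `m - 1` tiles of type 1 glued to its left and
`n` tiles of type 4 glued to its right, all tiles having `∞` as a vertex. -/
def jigsaw (m n : ℕ) (hm : 1 ≤ m) : Jigsaw where
  tiles := tilesOf m n
  isGluing := by
    obtain ⟨k, rfl⟩ := Nat.exists_eq_add_of_le' hm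
    exact isGluing_tilesOf k n
  normalized := ⟨1, Or.inl ⟨0, hm, leftTile_zero.symm⟩⟩

end Jigsaw

end

/-! Since √1 and √4 are rational, the generators of Γ are rational matrices. A parabolic matrix (a,
b; c, d) fixes ∞ or (a - d)/(2c), so every cusp is rational or ∞ (`groupLift_le_rationalSubgroup`).

Conversely, the cusps are stable under Γ and ∞ is one of them, so it suffices that the orbit Γ∞
contains ℚ. The Γ-images of the tiles of J all have their vertices in Γ∞. Each image tile is
recorded by frames, the isometries carrying `Δ_4` or `Δ_1` onto it. A type 4 tile always meets type
4 across its sides of types 4 and 1/4; across its side of type 1 either type may follow.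
`IsFrameSystem` retains only these alternatives, so one argument serves all m and n.

The argument is a descent on denominators (`IsFrameSystem.reaches`): a rational point is written [p
: q] in the coordinates of a frame, and another frame is found in which |q| is smaller, until q = 0
and the point is a vertex. By pigeonhole every frame has a period P (`exists_mul_translation_eq`),
which moves p/q to the right of -1. The fan of tiles around ∞ then allows steps of 1 (type 1) or 6
(three tiles of type 4), bringing p/q into [-1, 0] or [-1, 5]. There `reaches_of_mem_T` and
`reaches_of_mem_R` choose a frame whose vertex is close to p/q. The few points where the denominator
would not drop are shown to be vertices directly. -/

noncomputable section

namespace Jigsaw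

/-! ### Homogeneous coordinates on the boundary -/

/-- The boundary point with homogeneous coordinates `[p : q]`. -/
def ofHomogeneous (p q : ℝ) : OnePoint ℝ := if q = 0 then ∞ else ((p / q : ℝ) : OnePoint ℝ)

theorem onBoundary_ofHomogeneous (g : SL(2, ℝ)) {p q : ℝ} (h : p ≠ 0 ∨ q ≠ 0) :
    onBoundary g (ofHomogeneous p q) =
      ofHomogeneous (g 0 0 * p + g 0 1 * q) (g 1 0 * p + g 1 1 * q) := by
  by_cases hq : q = 0
  · have hp : p ≠ 0 := by simpa [hq] using h
    rw [ofHomogeneous, if_pos hq, onBoundary_infty, ofHomogeneous]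
    simp only [hq, mul_zero, add_zero, mul_eq_zero, hp, or_false]
    split_ifs
    · rfl
    · rw [mul_div_mul_right _ _ hp]
  · rw [ofHomogeneous, if_neg hq, onBoundary_coe, ofHomogeneous]
    have e : g 1 0 * (p / q) + g 1 1 = (g 1 0 * p + g 1 1 * q) / q := by field_simp
    have e' : g 0 0 * (p / q) + g 0 1 = (g 0 0 * p + g 0 1 * q) / q := by field_simp
    rw [e, e', div_div_div_cancel_right₀ hq]
    simp [hq]

theorem ofHomogeneous_mul {l : ℝ} (hl : l ≠ 0) (p q : ℝ) :
    ofHomogeneous (l * p) (l * q) = ofHomogeneous p q := by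
  by_cases hq : q = 0
  · simp [ofHomogeneous, hq]
  · simp [ofHomogeneous, hq, hl, mul_div_mul_left]

/-! ### The rotations about the marked points of `Δ_4` and `Δ_1` -/

/-- The rotation about the marked point of the side `[∞, -1]` of `Δ_4`, and of `Δ_1`. -/
def rotA₀ : SL(2, ℝ) := ⟨!![-1, -2; 1, 1], by rw [Matrix.det_fin_two_of]; norm_num⟩

/-- The rotation about the marked point of the side `[-1, 0]` of `Δ_4`. -/
def rotA₁ : SL(2, ℝ) := ⟨!![-2, -2; 5 / 2, 2], by rw [Matrix.det_fin_two_of]; norm_num⟩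

/-- The rotation about the marked point of the side `[0, ∞]` of `Δ_4`. -/
def rotA₂ : SL(2, ℝ) := ⟨!![0, -2; 1 / 2, 0], by rw [Matrix.det_fin_two_of]; norm_num⟩

/-- The rotation about the marked point of the side `[-1, 0]` of `Δ_1`. -/
def rotB₁ : SL(2, ℝ) := ⟨!![-1, -1; 2, 1], by rw [Matrix.det_fin_two_of]; norm_num⟩

/-- The rotation about the marked point of the side `[0, ∞]` of `Δ_1`. -/
def rotB₂ : SL(2, ℝ) := ⟨!![0, -1; 1, 0], by rw [Matrix.det_fin_two_of]; norm_num⟩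

/-- The symmetry `∞ ↦ -1 ↦ 0 ↦ ∞` of `Δ_1`. -/
def cyc : SL(2, ℝ) := ⟨!![-1, -1; 1, 0], by rw [Matrix.det_fin_two_of]; norm_num⟩

theorem translation_add (s t : ℝ) : translation (s + t) = translation s * translation t := by
  apply Subtype.ext
  simp only [Matrix.SpecialLinearGroup.coe_mul]
  simp [translation, add_comm]

/-! ### Systems of frames -/

/-- Two sets of frames `R` (for tiles of type 4) and `T` (for tiles of type 1) that are permuted by
crossing the sides of the tiles. A frame `g` stands for the tile `g Δ_4` or `g Δ_1`. The frames in
`T₀` are those whose side `[0, ∞]` is glued to the side `[∞, -1]` of a tile of type 4; the other two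
sides of such a tile are glued to tiles of type 1. The vertices of all tiles lie in `Ω`. -/
structure IsFrameSystem (Ω : Set (OnePoint ℝ)) (R T T₀ : Set SL(2, ℝ)) : Prop where
  neg_T : ∀ g ∈ T, -g ∈ T
  infty_R : ∀ g ∈ R, onBoundary g ∞ ∈ Ω
  infty_T : ∀ g ∈ T, onBoundary g ∞ ∈ Ω
  R₁ : ∀ g ∈ R, g * rotA₁ ∈ R
  R₂ : ∀ g ∈ R, g * rotA₂ ∈ R
  R₀ : ∀ g ∈ R, g * rotA₀ ∈ R ∨ g * translation (-1) ∈ T₀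
  cyc_T : ∀ g ∈ T, g * cyc ∈ T
  T₂ : ∀ g ∈ T, g * rotB₂ ∈ T ∨ g ∈ T₀
  T₀_sub : T₀ ⊆ T
  T₀_R : ∀ g ∈ T₀, g * translation 1 ∈ R
  T₀_0 : ∀ g ∈ T₀, g * rotA₀ ∈ T
  T₀_1 : ∀ g ∈ T₀, g * rotB₁ ∈ T

/-- The image under `g` of the boundary point `[p : q]` lies in `Ω`. -/
def Reaches (Ω : Set (OnePoint ℝ)) (g : SL(2, ℝ)) (p q : ℤ) : Prop :=
  onBoundary g (ofHomogeneous p q) ∈ Ω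

/-- Change of frame: h sends [p' : q'] to [p : q]. The factor l keeps the coordinates integral
although `rotA₁` and `rotA₂` have half-integral entries. -/
theorem Reaches.of_mul {Ω : Set (OnePoint ℝ)} {g h : SL(2, ℝ)} {p q p' q' : ℤ} (l : ℝ)
    (H : Reaches Ω (g * h) p' q') (hl : l ≠ 0) (hpq : p ≠ 0 ∨ q ≠ 0)
    (e₀ : h 0 0 * p' + h 0 1 * q' = l * p) (e₁ : h 1 0 * p' + h 1 1 * q' = l * q) :
    Reaches Ω g p q := by
  have h' : (p' : ℝ) ≠ 0 ∨ (q' : ℝ) ≠ 0 := by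
    by_contra! h0
    rw [h0.1, h0.2] at e₀ e₁
    simp [hl] at e₀ e₁
    rcases hpq with h | h
    · exact h (by exact_mod_cast e₀)
    · exact h (by exact_mod_cast e₁)
  unfold Reaches at *
  rwa [onBoundary_mul, onBoundary_ofHomogeneous h h', e₀, e₁, ofHomogeneous_mul hl] at H

theorem Reaches.of_scale {Ω : Set (OnePoint ℝ)} {g : SL(2, ℝ)} {p q k p' q' : ℤ}
    (H : Reaches Ω g p q) (hk : k ≠ 0) (hp : p' = k * p) (hq : q' = k * q) :
    Reaches Ω g p' q' := by
  subst hp hq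
  unfold Reaches at *
  push_cast
  rwa [ofHomogeneous_mul (by exact_mod_cast hk)]

/-! ### Points that are vertices in every frame system -/

namespace IsFrameSystem

variable {Ω : Set (OnePoint ℝ)} {R T T₀ : Set SL(2, ℝ)} {g : SL(2, ℝ)}

theorem reaches_R (S : IsFrameSystem Ω R T T₀) (hg : g ∈ R) : Reaches Ω g 1 0 := by
  simpa [Reaches, ofHomogeneous] using S.infty_R g hg

theorem reaches_T (S : IsFrameSystem Ω R T T₀) (hg : g ∈ T) : Reaches Ω g 1 0 := by
  simpa [Reaches, ofHomogeneous] using S.infty_T g hg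

/-- The third vertex of the tile on the other side of `[0, ∞]`. -/
theorem reaches_T_one (S : IsFrameSystem Ω R T T₀) (hg : g ∈ T) : Reaches Ω g 1 1 := by
  rcases S.T₂ g hg with h | h
  · have h1 : Reaches Ω (g * rotB₂) (-1) 1 :=
      (S.reaches_T (S.cyc_T _ h)).of_mul 1 one_ne_zero (by simp) (by simp [cyc]) (by simp [cyc])
    exact h1.of_mul (-1) (by simp) (by simp) (by simp [rotB₂]) (by simp [rotB₂])
  · have h1 : Reaches Ω (g * translation 1) 0 1 :=
      (S.reaches_R (S.R₂ _ (S.T₀_R g h))).of_mul (1 / 2) (by simp) (by simp) (by simp [rotA₂])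
        (by simp [rotA₂])
    exact h1.of_mul 1 (by simp) (by simp) (by simp [translation]) (by simp [translation])

/-- `cyc` maps 1 to -2 and -2 to -1/2, so these are the third vertices of the tiles across the other
two sides. -/
theorem reaches_T_neg_two (S : IsFrameSystem Ω R T T₀) (hg : g ∈ T) : Reaches Ω g (-2) 1 :=
  (S.reaches_T_one (S.cyc_T _ hg)).of_mul 1 (by simp) (by simp) (by simp [cyc]; norm_num)
    (by simp [cyc])

theorem reaches_T_neg_half (S : IsFrameSystem Ω R T T₀) (hg : g ∈ T) : Reaches Ω g (-1) 2 :=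
  (S.reaches_T_neg_two (S.cyc_T _ hg)).of_mul (-1) (by simp) (by simp) (by simp [cyc]; norm_num)
    (by simp [cyc])

theorem reaches_R_zero (S : IsFrameSystem Ω R T T₀) (hg : g ∈ R) : Reaches Ω g 0 1 :=
  (S.reaches_R (S.R₂ _ hg)).of_mul (1 / 2) (by simp) (by simp) (by simp [rotA₂]) (by simp [rotA₂])

theorem reaches_R_neg_one (S : IsFrameSystem Ω R T T₀) (hg : g ∈ R) : Reaches Ω g (-1) 1 :=
  (S.reaches_R_zero (S.R₁ _ hg)).of_mul 2 (by simp) (by simp) (by simp [rotA₁]) (by simp [rotA₁])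

/-- From a type 4 frame, the three tiles `g`, `g * rotA₂`, `g * rotA₂ * rotA₁` around ∞ have finite
vertices -1, 0, 4, 5. -/
theorem reaches_R_five (S : IsFrameSystem Ω R T T₀) (hg : g ∈ R) : Reaches Ω g 5 1 := by
  have h : Reaches Ω (g * rotA₂) (-4) 5 :=
    (S.reaches_R (S.R₁ _ (S.R₂ _ hg))).of_mul (1 / 2) (by simp) (by simp)
      (by simp [rotA₁]; norm_num) (by simp [rotA₁]; norm_num)
  exact h.of_mul (-2) (by simp) (by simp) (by simp [rotA₂]) (by simp [rotA₂]; norm_num)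

/-- The bottom side [0, 4] of the second tile of the fan has type 1. The tile across it has third
vertex 2, whether its type is 4 or 1. -/
theorem reaches_R_two (S : IsFrameSystem Ω R T T₀) (hg : g ∈ R) : Reaches Ω g 2 1 := by
  have h : Reaches Ω (g * rotA₂) (-2) 1 := by
    rcases S.R₀ _ (S.R₂ _ hg) with h | h
    · exact (S.reaches_R_zero h).of_mul 1 (by simp) (by simp) (by simp [rotA₀]) (by simp [rotA₀])
    · have h1 : Reaches Ω (g * rotA₂ * translation (-1)) (-1) 1 :=
        (S.reaches_T (S.cyc_T _ (S.T₀_sub h))).of_mul 1 (by simp) (by simp) (by simp [cyc])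
          (by simp [cyc])
      exact h1.of_mul 1 (by simp) (by simp) (by simp [translation]; norm_num)
        (by simp [translation])
  exact h.of_mul (-1) (by simp) (by simp) (by simp [rotA₂]) (by simp [rotA₂])

/-- The point 1, and likewise 3 below, lies deeper under [0, 4], and the tile it is a vertex of
depends on the type found across that side. For type 4 it is traced back to the point 2 of another
type 4 frame, for type 1 to a vertex of a neighbouring type 1 tile. -/
theorem reaches_R_one (S : IsFrameSystem Ω R T T₀) (hg : g ∈ R) : Reaches Ω g 1 1 := by
  have h : Reaches Ω (g * rotA₂) (-4) 1 := by
    rcases S.R₀ _ (S.R₂ _ hg) with h | h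
    · have h1 : Reaches Ω (g * rotA₂ * rotA₀ * rotA₁) (-2) 1 :=
        (S.reaches_R_two (S.R₂ _ (S.R₁ _ h))).of_mul 1 (by simp) (by simp)
          (by simp [rotA₂]) (by simp [rotA₂])
      have h2 : Reaches Ω (g * rotA₂ * rotA₀) (-2) 3 :=
        h1.of_mul (-1) (by simp) (by simp) (by simp [rotA₁]; norm_num) (by simp [rotA₁]; norm_num)
      exact h2.of_mul 1 (by simp) (by simp) (by simp [rotA₀]; norm_num) (by simp [rotA₀]; norm_num)
    · have h1 : Reaches Ω (g * rotA₂ * translation (-1)) (-3) 1 :=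
        (S.reaches_T_neg_half (S.T₀_0 _ h)).of_mul 1 (by simp) (by simp)
          (by simp [rotA₀]; norm_num) (by simp [rotA₀]; norm_num)
      exact h1.of_mul 1 (by simp) (by simp) (by simp [translation]; norm_num)
        (by simp [translation])
  exact h.of_mul (-2) (by simp) (by simp) (by simp [rotA₂]) (by simp [rotA₂]; norm_num)

theorem reaches_R_three (S : IsFrameSystem Ω R T T₀) (hg : g ∈ R) : Reaches Ω g 3 1 := by
  have h : Reaches Ω (g * rotA₂) (-4) 3 := by
    rcases S.R₀ _ (S.R₂ _ hg) with h | h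
    · exact (S.reaches_R_two h).of_mul 1 (by simp) (by simp) (by simp [rotA₀]; norm_num)
        (by simp [rotA₀]; norm_num)
    · have h1 : Reaches Ω (g * rotA₂ * translation (-1)) (-1) 3 :=
        (S.reaches_T_neg_two (S.T₀_1 _ h)).of_mul (-1) (by simp) (by simp)
          (by simp [rotB₁]; norm_num) (by simp [rotB₁]; norm_num)
      exact h1.of_mul 1 (by simp) (by simp) (by simp [translation]; norm_num)
        (by simp [translation])
  exact h.of_mul (-2) (by simp) (by simp) (by simp [rotA₂]) (by simp [rotA₂]; norm_num)

/-! ### Descent on the denominator -/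

/-- The descent in the triangle below `Δ_1`. -/
theorem reaches_of_mem_T (S : IsFrameSystem Ω R T T₀) {p q : ℤ} (hq : 0 < q)
    (ih : ∀ g ∈ R ∪ T, ∀ p' q' : ℤ, |q'| < q → Reaches Ω g p' q')
    (hg : g ∈ T) (h₁ : -q ≤ p) (h₂ : p ≤ 0) : Reaches Ω g p q := by
  have h1 : ∀ {g}, g ∈ T → Reaches Ω (g * cyc) q (-p - q) → Reaches Ω g p q := fun _ H =>
    H.of_mul 1 (by simp) (by omega) (by simp [cyc]) (by simp [cyc])
  refine h1 hg ?_
  -- In the frame `g * cyc` the denominator is -p - q, which is smaller than q except at p = 0;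
  -- there a second turn brings the point to ∞.
  rcases h₂.lt_or_eq with h | rfl
  · exact ih _ (Or.inr (S.cyc_T _ hg)) _ _ (by rw [abs_lt]; omega)
  · have h2 := ih _ (Or.inr (S.cyc_T _ (S.cyc_T _ hg))) (-q) 0 (by simpa using hq)
    exact h2.of_mul 1 (by simp) (by omega) (by simp [cyc]) (by simp [cyc])

/-- The descent in the three ideal triangles of type 4 with the common vertex `∞` that lie below
`[-1, 0]`, `[0, 4]` and `[4, 5]`. -/
theorem reaches_of_mem_R (S : IsFrameSystem Ω R T T₀) {p q : ℤ} (hq : 0 < q)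
    (ih : ∀ g ∈ R ∪ T, ∀ p' q' : ℤ, |q'| < q → Reaches Ω g p' q')
    (hg : g ∈ R) (h₁ : -q ≤ p) (h₂ : p ≤ 5 * q) : Reaches Ω g p q := by
  have hn : p ≠ 0 ∨ q ≠ 0 := by omega
  -- These frames carry ∞ to the vertices 0 and 4 seen from g, so the new denominators are |p| and
  -- |p - 4q|.
  have hg2 := S.R₂ _ hg
  have hg212 := S.R₂ _ (S.R₁ _ hg2)
  -- At -1, 1, 2, 3 and 5 the denominators used below for the frames at 0 and 4 equal q (at 2 after
  -- cancelling a factor 2), so these points are settled first.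
  by_cases e : p = -q
  · exact (S.reaches_R_neg_one hg).of_scale hq.ne' (by omega) (by omega)
  by_cases e : p = q
  · exact (S.reaches_R_one hg).of_scale hq.ne' (by omega) (by omega)
  by_cases e : p = 2 * q
  · exact (S.reaches_R_two hg).of_scale hq.ne' (by omega) (by omega)
  by_cases e : p = 3 * q
  · exact (S.reaches_R_three hg).of_scale hq.ne' (by omega) (by omega)
  by_cases e : p = 5 * q
  · exact (S.reaches_R_five hg).of_scale hq.ne' (by omega) (by omega)
  have left : Reaches Ω (g * rotA₂) (-4 * q) p → Reaches Ω g p q := fun H =>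
    H.of_mul (-2) (by simp) hn (by simp [rotA₂]) (by simp [rotA₂]; ring)
  have right : Reaches Ω (g * rotA₂ * rotA₁ * rotA₂) (4 * p - 20 * q) (p - 4 * q) →
      Reaches Ω g p q := by
    intro H
    have h1 : Reaches Ω (g * rotA₂ * rotA₁) (4 * q - p) (p - 5 * q) :=
      H.of_mul 2 (by simp) (by omega) (by simp [rotA₂]; ring) (by simp [rotA₂]; ring)
    have h2 : Reaches Ω (g * rotA₂) (-4 * q) p :=
      h1.of_mul (-1 / 2) (by simp) (by omega) (by simp [rotA₁]; ring) (by simp [rotA₁]; ring)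
    exact left h2
  by_cases c1 : p < q
  · exact left (ih _ (Or.inl hg2) _ _ (by rw [abs_lt]; omega))
  by_cases c3 : 3 * q < p
  · exact right (ih _ (Or.inl hg212) _ _ (by rw [abs_lt]; omega))
  -- For even p both new coordinates are even. Cancelling 2 halves the denominator, so each of the
  -- vertices 0 and 4 serves points up to distance 2.
  rcases Int.even_or_odd' p with ⟨r, rfl | hr⟩
  · by_cases c2 : r < q
    · exact left ((ih _ (Or.inl hg2) (-2 * q) r (by rw [abs_lt]; omega)).of_scale two_ne_zero
        (by ring) (by ring))
    · exact right ((ih _ (Or.inl hg212) (4 * r - 10 * q) (r - 2 * q)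
        (by rw [abs_lt]; omega)).of_scale two_ne_zero (by ring) (by ring))
  -- What remains has 1 < p/q < 3 and is looked for across the side [0, 4] of type 1. If a type 4
  -- tile follows, its frame at the vertex 2 has denominator |p - 2q| < q.
  refine left ?_
  rcases S.R₀ _ hg2 with h | h
  · have h1 := ih _ (Or.inl (S.R₂ _ h)) (2 * (p - 4 * q)) (p - 2 * q) (by rw [abs_lt]; omega)
    have h2 : Reaches Ω (g * rotA₂ * rotA₀) (4 * q - 2 * p) (p - 4 * q) :=
      h1.of_mul 1 (by simp) (by omega) (by simp [rotA₂]; ring) (by simp [rotA₂])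
    exact h2.of_mul (-1) (by simp) (by omega) (by simp [rotA₀]; ring) (by simp [rotA₀]; ring)
  · have h0 : Reaches Ω (g * rotA₂ * translation (-1)) (p - 4 * q) p →
        Reaches Ω (g * rotA₂) (-4 * q) p := fun H =>
      H.of_mul 1 (by simp) (by omega) (by simp [translation]; ring) (by simp [translation])
    refine h0 ?_
    -- If a type 1 tile follows, frames at the vertices 2, 4/3 and 8/3 have denominators |2p - 4q|,
    -- |3p - 4q| and |3p - 8q|. These are below q for p/q in (3/2, 5/2), (1, 5/3) and (7/3, 3),
    -- which cover (1, 3).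
    by_cases c2 : -q < 2 * p - 4 * q ∧ 2 * p - 4 * q < q
    · have h1 := ih _ (Or.inr (S.cyc_T _ (S.T₀_sub h))) p (4 * q - 2 * p)
        (by rw [abs_lt]; omega)
      exact h1.of_mul 1 (by simp) (by omega) (by simp [cyc]; ring) (by simp [cyc])
    by_cases c4 : p < 2 * q
    · have h1 := ih _ (Or.inr (S.cyc_T _ (S.cyc_T _ (S.T₀_0 _ h)))) (-p) (3 * p - 4 * q)
        (by rw [abs_lt]; omega)
      have h2 : Reaches Ω (g * rotA₂ * translation (-1) * rotA₀ * cyc) (4 * q - 2 * p) (-p) :=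
        h1.of_mul 1 (by simp) (by omega) (by simp [cyc]; ring) (by simp [cyc])
      have h3 : Reaches Ω (g * rotA₂ * translation (-1) * rotA₀) (3 * p - 4 * q)
          (4 * q - 2 * p) :=
        h2.of_mul 1 (by simp) (by omega) (by simp [cyc]; ring) (by simp [cyc])
      exact h3.of_mul 1 (by simp) (by omega) (by simp [rotA₀]; ring) (by simp [rotA₀]; ring)
    · have h1 := ih _ (Or.inr (S.T₀_1 _ h)) (2 * p - 4 * q) (8 * q - 3 * p)
        (by rw [abs_lt]; omega)
      exact h1.of_mul 1 (by simp) (by omega) (by simp [rotB₁]; ring) (by simp [rotB₁]; ring)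

/-- Moving to the right past one tile of type 1 or three tiles of type 4. -/
theorem mul_translation_mem_of_mem_T (S : IsFrameSystem Ω R T T₀) (hg : g ∈ T) :
    g * translation 1 ∈ R ∪ T := by
  rcases S.T₂ g hg with h | h
  · right
    have h1 := S.cyc_T _ (S.cyc_T _ h)
    convert h1 using 1
    rw [mul_assoc, mul_assoc]
    congr 1
    apply Subtype.ext
    simp only [Matrix.SpecialLinearGroup.coe_mul]
    simp [rotB₂, cyc, translation]
  · exact Or.inl (S.T₀_R _ h)

/-- The fan of three tiles over -1, 0, 4, 5 has total width 6 and ends in a side of type 1, as it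
began. If type 4 follows, `rotA₂ * rotA₁ * rotA₀` is exactly the translation by 6; if type 1
follows, two turns by `cyc` give that translation up to sign, whence `neg_T`. -/
theorem mul_translation_mem_of_mem_R (S : IsFrameSystem Ω R T T₀) (hg : g ∈ R) :
    g * translation 6 ∈ R ∪ T := by
  rcases S.R₀ _ (S.R₁ _ (S.R₂ _ hg)) with h | h
  · left
    convert h using 1
    rw [mul_assoc, mul_assoc]
    congr 1
    apply Subtype.ext
    simp only [Matrix.SpecialLinearGroup.coe_mul]
    simp [rotA₀, rotA₁, rotA₂, translation]
    norm_num
  · right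
    convert S.neg_T _ (S.cyc_T _ (S.cyc_T _ (S.T₀_sub h))) using 1
    rw [mul_assoc, mul_assoc, mul_assoc, mul_assoc, ← mul_neg]
    congr 1
    apply Subtype.ext
    simp only [Matrix.SpecialLinearGroup.coe_mul, Matrix.SpecialLinearGroup.coe_neg]
    simp [cyc, rotA₁, rotA₂, translation]
    norm_num

theorem exists_mul_translation_mem (S : IsFrameSystem Ω R T T₀) (hg : g ∈ R ∪ T) :
    ∃ t : ℕ, 0 < t ∧ g * translation t ∈ R ∪ T := by
  rcases hg with hg | hg
  · exact ⟨6, by simp, by exact_mod_cast S.mul_translation_mem_of_mem_R hg⟩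
  · exact ⟨1, by simp, by exact_mod_cast S.mul_translation_mem_of_mem_T hg⟩

theorem reaches_of_translation {t p q : ℤ} (hq : q ≠ 0)
    (h : Reaches Ω (g * translation t) (p - t * q) q) : Reaches Ω g p q :=
  h.of_mul 1 (by simp) (by omega) (by simp [translation]) (by simp [translation])

/-- The descent for points to the right of `-1`. -/
theorem reaches_of_neg_one_le (S : IsFrameSystem Ω R T T₀) {q : ℤ} (hq : 0 < q)
    (ih : ∀ g ∈ R ∪ T, ∀ p' q' : ℤ, |q'| < q → Reaches Ω g p' q') (N : ℕ) :
    ∀ g ∈ R ∪ T, ∀ p : ℤ, -q ≤ p → p ≤ N → Reaches Ω g p q := by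
  induction N using Nat.strong_induction_on with
  | _ N IH =>
    rintro g (hg | hg) p h1 h2
    · by_cases h : p ≤ 5 * q
      · exact S.reaches_of_mem_R hq ih hg h1 h
      -- The window [-1, 5] has the width of the step, so p > 5q gives p - 6q > -q and the point
      -- stays to the right of -1.
      · refine reaches_of_translation (t := 6) hq.ne' (IH (p - 6 * q).toNat (by omega) _
          (by exact_mod_cast S.mul_translation_mem_of_mem_R hg) _ (by omega) (by omega))
    · by_cases h : p ≤ 0
      · exact S.reaches_of_mem_T hq ih hg h1 h
      · refine reaches_of_translation (t := 1) hq.ne' (IH (p - 1 * q).toNat (by omega) _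
          (by exact_mod_cast S.mul_translation_mem_of_mem_T hg) _ (by omega) (by omega))

/-- In a frame system that is invariant under a translation at each vertex, all rational points are
vertices. -/
theorem reaches (S : IsFrameSystem Ω R T T₀)
    (hP : ∀ g ∈ R ∪ T, ∃ P : ℕ, 0 < P ∧ ∀ x, onBoundary (g * translation P) x ∈ Ω →
      onBoundary g x ∈ Ω) (d : ℕ) :
    ∀ g ∈ R ∪ T, ∀ p q : ℤ, |q| = d → Reaches Ω g p q := by
  induction d using Nat.strong_induction_on with
  | _ d IH =>
    have key : ∀ q : ℤ, 0 < q → q = d → ∀ g ∈ R ∪ T, ∀ p : ℤ, Reaches Ω g p q := by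
      intro q hq hqd g hg p
      obtain ⟨P, hP0, hP⟩ := hP g hg
      have ih : ∀ g ∈ R ∪ T, ∀ p' q' : ℤ, |q'| < q → Reaches Ω g p' q' := fun g hg p' q' h =>
        IH q'.natAbs (by rw [← Int.natCast_natAbs] at h; omega) g hg p' q' (by simp)
      have step (p : ℤ) (h : Reaches Ω g (p + P * q) q) : Reaches Ω g p q := by
        apply hP
        rw [onBoundary_mul, onBoundary_ofHomogeneous _ (Or.inr (by exact_mod_cast hq.ne'))]
        simpa [Reaches, translation] using h
      have steps (k : ℕ) : ∀ p : ℤ, Reaches Ω g (p + k * (P * q)) q → Reaches Ω g p q := by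
        induction k with
        | zero => intro p h; simpa using h
        | succ k ihk =>
          intro p h
          refine step p (ihk _ ?_)
          convert h using 1
          push_cast
          ring
      -- Since P * q ≥ 1, a shift by |p| periods makes the numerator nonnegative.
      apply steps p.natAbs
      have h1 : (1 : ℤ) ≤ P * q := one_le_mul_of_one_le_of_one_le (by omega) (by omega)
      have h2 : |p| * 1 ≤ |p| * (P * q) := mul_le_mul_of_nonneg_left h1 (abs_nonneg p)
      have h3 := neg_abs_le p
      rw [Int.natCast_natAbs]
      exact S.reaches_of_neg_one_le hq ih (p + |p| * (P * q)).toNat g hg _ (by linarith)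
        (Int.self_le_toNat _)
    intro g hg p q hq
    rcases lt_trichotomy q 0 with h | rfl | h
    · rw [abs_of_neg h] at hq
      exact (key (-q) (by omega) hq g hg (-p)).of_scale (k := -1) (by simp) (by ring) (by ring)
    -- This includes p = 0, because `ofHomogeneous 0 0` is ∞ by convention.
    · have h1 : onBoundary g ∞ ∈ Ω := hg.elim (S.infty_R g) (S.infty_T g)
      simpa [Reaches, ofHomogeneous] using h1
    · rw [abs_of_pos h] at hq
      exact key q h hq g hg p

end IsFrameSystem

/-! ### The preimage of the jigsaw group in `SL(2, ℝ)` and the orbit of `∞` -/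

/-- The preimage of the jigsaw group in `SL(2, ℝ)`. -/
def groupLift (J : Jigsaw) : Subgroup SL(2, ℝ) :=
  J.group.comap (QuotientGroup.mk' (Subgroup.center SL(2, ℝ)))

/-- The orbit of `∞` under the jigsaw group. -/
def orbitInfty (J : Jigsaw) : Set (OnePoint ℝ) := {x | ∃ γ ∈ groupLift J, onBoundary γ ∞ = x}

theorem rotMatrix_mem_groupLift {J : Jigsaw} {s : Side} (hs : s ∈ exteriorSides J.tiles) :
    rotMatrix s.mark ∈ groupLift J :=
  Subgroup.subset_closure ⟨s, hs, rfl⟩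

theorem neg_one_mem_groupLift (J : Jigsaw) : -1 ∈ groupLift J := by
  have h : (-1 : SL(2, ℝ)) ∈ Subgroup.center SL(2, ℝ) := by
    rw [Subgroup.mem_center_iff]
    intro g
    simp
  change QuotientGroup.mk' _ (-1 : SL(2, ℝ)) ∈ J.group
  rw [QuotientGroup.mk'_apply, (QuotientGroup.eq_one_iff _).2 h]
  exact one_mem _

theorem onBoundary_one (x : OnePoint ℝ) : onBoundary 1 x = x := by simp [onBoundary]

theorem infty_mem_orbitInfty (J : Jigsaw) : ∞ ∈ orbitInfty J := ⟨1, one_mem _, onBoundary_one _⟩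

theorem onBoundary_mem_orbitInfty {J : Jigsaw} {γ : SL(2, ℝ)} (hγ : γ ∈ groupLift J)
    {x : OnePoint ℝ} (hx : x ∈ orbitInfty J) : onBoundary γ x ∈ orbitInfty J := by
  obtain ⟨δ, hδ, rfl⟩ := hx
  exact ⟨γ * δ, mul_mem hγ hδ, onBoundary_mul _ _ _⟩

theorem Side.Good.onBoundary_src {s : Side} (h : s.Good) :
    onBoundary (rotMatrix s.mark) s.src = s.tgt := congrArg Side.src h

theorem Side.Good.onBoundary_tgt {s : Side} (h : s.Good) :
    onBoundary (rotMatrix s.mark) s.tgt = s.src := congrArg Side.tgt h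

/-- The generator at an exterior side interchanges its two endpoints. -/
theorem tgt_mem_orbitInfty {J : Jigsaw} {s : Side} (hs : s ∈ exteriorSides J.tiles) (hg : s.Good)
    (h : s.src ∈ orbitInfty J) : s.tgt ∈ orbitInfty J := by
  rw [← hg.onBoundary_src]
  exact onBoundary_mem_orbitInfty (rotMatrix_mem_groupLift hs) h

/-! ### The frames of the tiles of `J_{m,n}` -/

/-- The rotation about the marked point of the `i`-th side of `Δ_n`. -/
def deltaRot (n : ℕ+) (i : Fin 3) : SL(2, ℝ) := rotMatrix ((Delta n).side i).mark

theorem sqrt_four : √(((4 : ℕ+) : ℕ) : ℝ) = 2 := by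
  rw [show (((4 : ℕ+) : ℕ) : ℝ) = 2 ^ 2 by norm_num]
  exact Real.sqrt_sq (by norm_num)

theorem rotMatrix_mk (x y : ℝ) (hy : 0 < y) : (rotMatrix ⟨⟨x, y⟩, hy⟩).1 =
    !![x / y, -(x ^ 2 + y ^ 2) / y; 1 / y, -x / y] := rfl

theorem deltaRot_four_zero : deltaRot 4 0 = rotA₀ := by
  apply Subtype.ext
  refine (rotMatrix_mk _ _ _).trans ?_
  norm_num [rotA₀]

theorem deltaRot_four_one : deltaRot 4 1 = rotA₁ := by
  apply Subtype.ext
  refine (rotMatrix_mk _ _ _).trans ?_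
  rw [sqrt_four]
  norm_num [rotA₁]

theorem deltaRot_four_two : deltaRot 4 2 = rotA₂ := by
  apply Subtype.ext
  refine (rotMatrix_mk _ _ _).trans ?_
  rw [sqrt_four]
  norm_num [rotA₂]

theorem deltaRot_one_zero : deltaRot 1 0 = rotA₀ := by
  apply Subtype.ext
  refine (rotMatrix_mk _ _ _).trans ?_
  norm_num [rotA₀]

theorem deltaRot_one_one : deltaRot 1 1 = rotB₁ := by
  apply Subtype.ext
  refine (rotMatrix_mk _ _ _).trans ?_
  norm_num [rotB₁]

/-- The isometries carrying `Δ_4` to the tiles of type 4 of `J_{m,n}`. -/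
def rightFrame : ℕ → SL(2, ℝ)
  | 0 => translation 1
  | k + 1 => rightFrame k * deltaRot 4 (rightIndex k)

theorem rotMatrix_map_mark (g : SL(2, ℝ)) (n : ℕ+) (i : Fin 3) :
    rotMatrix (((Delta n).map g).side i).mark * g = g * deltaRot n i := rotMatrix_smul _ _

theorem rightTile_eq (k : ℕ) : rightTile k = (Delta 4).map (rightFrame k) := by
  induction k with
  | zero => rfl
  | succ k ih => rw [rightTile, ih, Tile.map_map, rotMatrix_map_mark, rightFrame]

theorem deltaRot_mul_self (n : ℕ+) (i : Fin 3) : deltaRot n i * deltaRot n i = -1 :=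
  rotMatrix_mul_self _

theorem cyc_pow_three : cyc ^ 3 = 1 := by
  rw [pow_three]
  apply Subtype.ext
  simp only [Matrix.SpecialLinearGroup.coe_mul]
  simp [cyc, Matrix.one_fin_two]

/-! ### The exterior sides of `J_{m,n}` -/

/-- All tiles lie above their finite sides, which therefore run from left to right. No such side can
be the reverse of another, so every finite side is exterior. -/
theorem src_lt_tgt {m n : ℕ} {T : Tile} (hT : T ∈ tilesOf m n) (i : Fin 3) {x y : ℝ}
    (hx : (T.side i).src = x) (hy : (T.side i).tgt = y) : x < y := by
  rcases hT with ⟨j, -, rfl⟩ | ⟨k, -, rfl⟩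
  · obtain ⟨h1, h2, h3, h4, h5, h6⟩ := leftTile_ends j
    fin_cases i
    · exact absurd (h1.symm.trans hx) (OnePoint.infty_ne_coe _)
    · have e1 := OnePoint.coe_injective (h3.symm.trans hx)
      have e2 := OnePoint.coe_injective (h4.symm.trans hy)
      linarith
    · exact absurd (h6.symm.trans hy) (OnePoint.infty_ne_coe _)
  · obtain ⟨a, b, -, hab, h1, h2, h3, h4, h5, h6⟩ := rightTile_ends k
    have hi : i = rightIndex k ∨ i = rightIndex k + 1 ∨ i = rightIndex k + 2 := by
      clear hx hy
      generalize rightIndex k = r; revert r i; decide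
    rcases hi with rfl | rfl | rfl
    · exact absurd (h2.symm.trans hy) (OnePoint.infty_ne_coe _)
    · exact absurd (h3.symm.trans hx) (OnePoint.infty_ne_coe _)
    · have e1 := OnePoint.coe_injective (h5.symm.trans hx)
      have e2 := OnePoint.coe_injective (h6.symm.trans hy)
      linarith

theorem mem_exteriorSides_of_finite {m n : ℕ} {T : Tile} (hT : T ∈ tilesOf m n) {i : Fin 3}
    {x y : ℝ} (hx : (T.side i).src = x) (hy : (T.side i).tgt = y) :
    T.side i ∈ exteriorSides (tilesOf m n) := by
  refine ⟨⟨T, hT, i, rfl⟩, fun T' hT' i' h => ?_⟩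
  have h1 := src_lt_tgt hT i hx hy
  have h2 := src_lt_tgt hT' i' ((congrArg Side.src h).trans hy) ((congrArg Side.tgt h).trans hx)
  exact lt_asymm h1 h2

theorem leftTile_bottom_mem {m n i : ℕ} (hi : i < m) :
    (leftTile i).side 1 ∈ exteriorSides (tilesOf m n) :=
  mem_exteriorSides_of_finite (Or.inl ⟨i, hi, rfl⟩) (leftTile_ends i).2.2.1
    (leftTile_ends i).2.2.2.1

theorem rightTile_bottom_mem {m n k : ℕ} (hk : k < n) :
    (rightTile k).side (rightIndex k + 2) ∈ exteriorSides (tilesOf m n) := by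
  obtain ⟨a, b, -, -, -, -, -, -, h5, h6⟩ := rightTile_ends k
  exact mem_exteriorSides_of_finite (Or.inr ⟨k, hk, rfl⟩) h5 h6

theorem leftTile_last_mem (m n : ℕ) :
    (leftTile m).side 0 ∈ exteriorSides (tilesOf (m + 1) n) := by
  obtain ⟨h1, h2, -⟩ := leftTile_ends m
  refine ⟨⟨_, Or.inl ⟨m, by omega, rfl⟩, 0, rfl⟩, fun T hT i h => ?_⟩
  have hs := (congrArg Side.src h).trans h2
  have ht := (congrArg Side.tgt h).trans h1
  have hm0 : (0 : ℝ) ≤ m := m.cast_nonneg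
  rcases hT with ⟨j, hj, rfl⟩ | ⟨k, -, rfl⟩
  · obtain ⟨g1, g2, g3, g4, g5, g6⟩ := leftTile_ends j
    fin_cases i
    · exact OnePoint.infty_ne_coe _ (g1.symm.trans hs)
    · exact OnePoint.coe_ne_infty _ (g4.symm.trans ht)
    · have e := OnePoint.coe_injective (g5.symm.trans hs)
      have e : (j : ℝ) = m + 1 := by linarith
      have e : j = m + 1 := by exact_mod_cast e
      omega
  · obtain ⟨a, b, ha, hab, g1, g2, g3, g4, g5, g6⟩ := rightTile_ends k
    have hi : i = rightIndex k ∨ i = rightIndex k + 1 ∨ i = rightIndex k + 2 := by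
      clear h hs ht
      generalize rightIndex k = r; revert r i; decide
    rcases hi with rfl | rfl | rfl
    · have e := OnePoint.coe_injective (g1.symm.trans hs)
      linarith
    · exact OnePoint.infty_ne_coe _ (g3.symm.trans hs)
    · exact OnePoint.coe_ne_infty _ (g6.symm.trans ht)

theorem rightTile_last_mem (m n : ℕ) :
    (rightTile n).side (rightIndex n) ∈ exteriorSides (tilesOf m (n + 1)) := by
  obtain ⟨v, hv, hv0, hr⟩ := exists_rightVertex
  refine ⟨⟨_, Or.inr ⟨n, by omega, rfl⟩, _, rfl⟩, fun T hT i h => ?_⟩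
  have hs := (congrArg Side.src h).trans (hr n).2.1
  have ht := (congrArg Side.tgt h).trans (hr n).1
  rcases hT with ⟨j, -, rfl⟩ | ⟨k, hk, rfl⟩
  · obtain ⟨g1, g2, g3, g4, g5, g6⟩ := leftTile_ends j
    fin_cases i
    · have e := OnePoint.coe_injective (g2.symm.trans ht)
      have hj0 : (0 : ℝ) ≤ j := j.cast_nonneg
      have : v 0 ≤ v (n + 1) := hv.monotone (by omega)
      linarith
    · exact OnePoint.coe_ne_infty _ (g3.symm.trans hs)
    · exact OnePoint.coe_ne_infty _ (g5.symm.trans hs)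
  · have e := OnePoint.coe_injective (((hr k).2.2 i hs).symm.trans ht)
    have := hv.injective e
    omega

/-! ### The vertices of the tiles of `J_{m,n}` lie in the orbit of `∞` -/

/-- The rotation at the leftmost vertical side sends ∞ to the vertex -(m + 1); the rotations at the
bottom sides then carry each vertex to the next one on its right. -/
theorem leftVertex_mem_orbitInfty (m n : ℕ) (i : ℕ) (hi : i ≤ m + 1) :
    ((-(i : ℝ) : ℝ) : OnePoint ℝ) ∈ orbitInfty (jigsaw (m + 1) n (by omega)) := by
  induction hi using Nat.decreasingInduction with
  | self =>
    have h := tgt_mem_orbitInfty (J := jigsaw (m + 1) n (by omega)) (leftTile_last_mem m n)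
      ((Delta_good 1 0).map _) ((leftTile_ends m).1 ▸ infty_mem_orbitInfty _)
    rw [(leftTile_ends m).2.1] at h
    convert h using 2
    push_cast
    ring
  | of_succ i hi ih =>
    have hs : ((leftTile i).side 1).src = ((-((i + 1 : ℕ) : ℝ) : ℝ) : OnePoint ℝ) := by
      rw [(leftTile_ends i).2.2.1]
      congr 1
      push_cast
      ring
    have h := tgt_mem_orbitInfty (J := jigsaw (m + 1) n (by omega))
      (leftTile_bottom_mem (by omega)) ((Delta_good 1 1).map _) (hs ▸ ih)
    rw [(leftTile_ends i).2.2.2.1] at h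
    simpa using h

theorem Delta_tgt (n : ℕ+) (i : Fin 3) : ((Delta n).side i).tgt = ((Delta n).side (i + 1)).src := by
  fin_cases i <;> rfl

theorem rightVertex_mem_orbitInfty {m n : ℕ} (k : ℕ) (hk : k < n) (i : Fin 3) :
    onBoundary (rightFrame k) ((Delta 4).side i).src ∈
      orbitInfty (jigsaw (m + 1) n (by omega)) := by
  have bottom {k : ℕ} (hk : k < n) (h : onBoundary (rightFrame k)
      ((Delta 4).side (rightIndex k + 2)).src ∈ orbitInfty (jigsaw (m + 1) n (by omega))) :
      onBoundary (rightFrame k) ((Delta 4).side (rightIndex k + 2 + 1)).src ∈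
        orbitInfty (jigsaw (m + 1) n (by omega)) := by
    have hs := rightTile_bottom_mem (m := m + 1) hk
    rw [rightTile_eq] at hs
    rw [← Delta_tgt]
    exact tgt_mem_orbitInfty (J := jigsaw (m + 1) n (by omega)) hs ((Delta_good 4 _).map _) h
  induction k generalizing i with
  | zero =>
    have h1 : onBoundary (rightFrame 0) ((Delta 4).side 1).src ∈
        orbitInfty (jigsaw (m + 1) n (by omega)) := by
      have h := leftVertex_mem_orbitInfty m n 0 (by omega)
      rw [show ((Delta 4).side 1).src = ((-1 : ℝ) : OnePoint ℝ) from rfl, rightFrame,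
        translation_coe]
      convert h using 2
      simp
    fin_cases i
    · change onBoundary (translation 1) ∞ ∈ _
      rw [translation_infty]
      exact infty_mem_orbitInfty _
    · exact h1
    · exact bottom hk h1
  | succ k ih =>
    have hi : i = rightIndex k ∨ i = rightIndex k + 1 ∨ i = rightIndex k + 2 := by
      clear ih
      generalize rightIndex k = r; revert r i; decide
    have hgood := Delta_good 4 (rightIndex k)
    -- Consecutive frames differ by a rotation that swaps the ends of the shared side, so two of the
    -- three vertices come from the previous tile. The third is reached along the bottom side.
    have h1 : onBoundary (rightFrame (k + 1)) ((Delta 4).side (rightIndex k + 1)).src ∈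
        orbitInfty (jigsaw (m + 1) n (by omega)) := by
      rw [rightFrame, onBoundary_mul, ← Delta_tgt, deltaRot, hgood.onBoundary_tgt]
      exact ih (by omega) _ bottom
    rcases hi with rfl | rfl | rfl
    · rw [rightFrame, onBoundary_mul, deltaRot, hgood.onBoundary_src, Delta_tgt]
      exact ih (by omega) _ bottom
    · exact h1
    · have e1 : rightIndex (k + 1) + 2 = rightIndex k + 1 := by
        rw [rightIndex_succ]; generalize rightIndex k = r; revert r; decide
      have e2 : rightIndex (k + 1) + 2 + 1 = rightIndex k + 2 := by
        rw [rightIndex_succ]; generalize rightIndex k = r; revert r; decide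
      have h := bottom hk
      rw [e2, e1] at h
      exact h h1

/-! ### The frame system of `J_{m,n}` -/

/-- The frames of the tiles of type 4 in the orbit of `J_{m,n}`. -/
def rightFrames (J : Jigsaw) (n : ℕ) : Set SL(2, ℝ) :=
  {x | ∃ γ ∈ groupLift J, ∃ k < n, x = γ * rightFrame k}

/-- The frames of the tiles of type 1 in the orbit of `J_{m,n}`. -/
def leftFrames (J : Jigsaw) (m : ℕ) : Set SL(2, ℝ) :=
  {x | ∃ γ ∈ groupLift J, ∃ i < m, ∃ j < 3, x = γ * (translation (-(i : ℝ)) * cyc ^ j)}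

theorem mul_mem_rightFrames {J : Jigsaw} {n : ℕ} {γ g : SL(2, ℝ)} (hγ : γ ∈ groupLift J)
    (hg : g ∈ rightFrames J n) : γ * g ∈ rightFrames J n := by
  obtain ⟨δ, hδ, k, hk, rfl⟩ := hg
  exact ⟨γ * δ, mul_mem hγ hδ, k, hk, by rw [mul_assoc]⟩

theorem mul_mem_leftFrames {J : Jigsaw} {m : ℕ} {γ g : SL(2, ℝ)} (hγ : γ ∈ groupLift J)
    (hg : g ∈ leftFrames J m) : γ * g ∈ leftFrames J m := by
  obtain ⟨δ, hδ, i, hi, j, hj, rfl⟩ := hg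
  exact ⟨γ * δ, mul_mem hγ hδ, i, hi, j, hj, by rw [mul_assoc]⟩

theorem neg_mem_leftFrames {J : Jigsaw} {m : ℕ} {g : SL(2, ℝ)} (hg : g ∈ leftFrames J m) :
    -g ∈ leftFrames J m := by
  simpa using mul_mem_leftFrames (neg_one_mem_groupLift J) hg

theorem translation_mul_cyc_pow_mem {J : Jigsaw} {m i : ℕ} (hi : i < m) (j : ℕ) :
    translation (-(i : ℝ)) * cyc ^ j ∈ leftFrames J m :=
  ⟨1, one_mem _, i, hi, j % 3, Nat.mod_lt _ (by simp), by
    rw [one_mul, ← pow_eq_pow_mod j cyc_pow_three]⟩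

theorem mul_deltaRot_of_exterior {J : Jigsaw} {g : SL(2, ℝ)} {n : ℕ+} {i : Fin 3}
    (h : ((Delta n).map g).side i ∈ exteriorSides J.tiles) :
    ∃ γ ∈ groupLift J, g * deltaRot n i = γ * g :=
  ⟨_, rotMatrix_mem_groupLift h, (rotMatrix_map_mark g n i).symm⟩

/-- The right vertical side leads to the next tile or is exterior, the left one leads to the
previous tile, and the bottom is exterior; at an exterior side the rotation lies in the group. The
excluded case is the side glued to `Δ_1`. -/
theorem rightFrame_mul_deltaRot_mem {m n k : ℕ} (hk : k < n) (i : Fin 3) (h : k ≠ 0 ∨ i ≠ 0) :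
    rightFrame k * deltaRot 4 i ∈ rightFrames (jigsaw (m + 1) n (by omega)) n := by
  have ext {i : Fin 3} (hi : (rightTile k).side i ∈ exteriorSides (tilesOf (m + 1) n)) :
      rightFrame k * deltaRot 4 i ∈ rightFrames (jigsaw (m + 1) n (by omega)) n := by
    rw [rightTile_eq] at hi
    obtain ⟨γ, hγ, e⟩ := mul_deltaRot_of_exterior (J := jigsaw (m + 1) n (by omega)) hi
    exact ⟨γ, hγ, k, hk, e⟩
  have hi : i = rightIndex k ∨ i = rightIndex k + 1 ∨ i = rightIndex k + 2 := by
    clear h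
    generalize rightIndex k = r; revert r i; decide
  rcases hi with rfl | rfl | rfl
  · by_cases hk' : k + 1 < n
    · exact ⟨1, one_mem _, k + 1, hk', by rw [one_mul, rightFrame]⟩
    · obtain rfl : n = k + 1 := by omega
      exact ext (rightTile_last_mem _ _)
  · rcases k with _ | k
    · exact absurd rfl (h.resolve_left (by simp))
    · have e : rightIndex (k + 1) + 1 = rightIndex k := by
        rw [rightIndex_succ]; generalize rightIndex k = r; revert r; decide
      -- Crossing the same side twice is the identity only up to sign.
      refine ⟨-1, neg_one_mem_groupLift _, k, by omega, ?_⟩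
      rw [e, rightFrame, mul_assoc, deltaRot_mul_self, mul_neg, neg_mul, one_mul, mul_one]
  · exact ext (rightTile_bottom_mem hk)

theorem rotB₂_eq : rotB₂ = translation 1 * cyc := by
  apply Subtype.ext
  simp only [Matrix.SpecialLinearGroup.coe_mul]
  simp [rotB₂, cyc, translation]

theorem rotA₀_eq : rotA₀ = -(translation (-1) * cyc ^ 2) := by
  rw [pow_two]
  apply Subtype.ext
  simp only [Matrix.SpecialLinearGroup.coe_mul, Matrix.SpecialLinearGroup.coe_neg]
  simp [rotA₀, cyc, translation]
  norm_num

/-- Turning `Δ_1` conjugates the crossing of [0, ∞] into that of [∞, -1], and a second turn into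
that of [-1, 0]. -/
theorem cyc_mul_rotB₂ : cyc * rotB₂ = rotA₀ * cyc := by
  apply Subtype.ext
  simp only [Matrix.SpecialLinearGroup.coe_mul]
  simp [rotA₀, cyc, rotB₂]
  norm_num

theorem cyc_sq_mul_rotB₂ : cyc ^ 2 * rotB₂ = rotB₁ * cyc ^ 2 := by
  rw [pow_two]
  apply Subtype.ext
  simp only [Matrix.SpecialLinearGroup.coe_mul]
  simp [rotB₁, cyc, rotB₂]
  norm_num

theorem mul_cyc_mem_leftFrames {J : Jigsaw} {m : ℕ} {g : SL(2, ℝ)} (hg : g ∈ leftFrames J m) :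
    g * cyc ∈ leftFrames J m := by
  obtain ⟨δ, hδ, i, hi, j, hj, rfl⟩ := hg
  rw [mul_assoc, mul_assoc, ← pow_succ]
  exact mul_mem_leftFrames hδ (translation_mul_cyc_pow_mem hi _)

theorem translation_mul_rotA₀_mem {m n i : ℕ} (hi : i < m + 1) :
    translation (-(i : ℝ)) * rotA₀ ∈ leftFrames (jigsaw (m + 1) n (by omega)) (m + 1) := by
  by_cases hi' : i < m
  · rw [rotA₀_eq, mul_neg, ← mul_assoc, ← translation_add]
    refine neg_mem_leftFrames ?_
    convert translation_mul_cyc_pow_mem (show i + 1 < m + 1 by omega) 2 using 3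
    push_cast
    ring
  · obtain rfl : i = m := by omega
    obtain ⟨γ, hγ, e⟩ := mul_deltaRot_of_exterior (J := jigsaw (i + 1) n (by omega))
      (leftTile_last_mem i n)
    rw [← deltaRot_one_zero, e]
    exact mul_mem_leftFrames hγ (by simpa using translation_mul_cyc_pow_mem hi 0)

theorem translation_mul_rotB₁_mem {m n i : ℕ} (hi : i < m + 1) :
    translation (-(i : ℝ)) * rotB₁ ∈ leftFrames (jigsaw (m + 1) n (by omega)) (m + 1) := by
  obtain ⟨γ, hγ, e⟩ := mul_deltaRot_of_exterior (J := jigsaw (m + 1) n (by omega))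
    (leftTile_bottom_mem hi)
  rw [← deltaRot_one_one, e]
  exact mul_mem_leftFrames hγ (by simpa using translation_mul_cyc_pow_mem hi 0)

theorem translation_zero : translation 0 = 1 := by
  apply Subtype.ext
  simp [translation, Matrix.one_fin_two]

/-- `T₀` is the group itself: γ is the frame of the copy γ`Δ_1`, and `Δ_1` is the only tile of type
1 glued to one of type 4. -/
theorem isFrameSystem_jigsaw (m n : ℕ) (hn : 1 ≤ n) :
    IsFrameSystem (orbitInfty (jigsaw (m + 1) n (by omega)))
      (rightFrames (jigsaw (m + 1) n (by omega)) n)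
      (leftFrames (jigsaw (m + 1) n (by omega)) (m + 1))
      (groupLift (jigsaw (m + 1) n (by omega))) where
  neg_T _ := neg_mem_leftFrames
  infty_R := by
    rintro _ ⟨γ, hγ, k, hk, rfl⟩
    rw [onBoundary_mul]
    exact onBoundary_mem_orbitInfty hγ (rightVertex_mem_orbitInfty k hk 0)
  infty_T := by
    rintro _ ⟨γ, hγ, i, hi, j, hj, rfl⟩
    rw [onBoundary_mul]
    refine onBoundary_mem_orbitInfty hγ ?_
    have c0 : onBoundary cyc ∞ = ((-1 : ℝ) : OnePoint ℝ) := by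
      rw [onBoundary_infty]; simp [cyc]
    have c1 : onBoundary cyc ((-1 : ℝ) : OnePoint ℝ) = ((0 : ℝ) : OnePoint ℝ) := by
      rw [onBoundary_coe]; simp [cyc]
    rw [onBoundary_mul]
    interval_cases j
    · rw [pow_zero, onBoundary_one, translation_infty]
      exact infty_mem_orbitInfty _
    · rw [pow_one, c0, translation_coe]
      convert leftVertex_mem_orbitInfty m n (i + 1) (by omega) using 2
      push_cast
      ring
    · rw [pow_two, onBoundary_mul, c0, c1, translation_coe]
      convert leftVertex_mem_orbitInfty m n i (by omega) using 2
      ring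
  R₁ := by
    rintro _ ⟨γ, hγ, k, hk, rfl⟩
    rw [mul_assoc, ← deltaRot_four_one]
    exact mul_mem_rightFrames hγ (rightFrame_mul_deltaRot_mem hk _ (by simp))
  R₂ := by
    rintro _ ⟨γ, hγ, k, hk, rfl⟩
    rw [mul_assoc, ← deltaRot_four_two]
    exact mul_mem_rightFrames hγ (rightFrame_mul_deltaRot_mem hk _ (by simp))
  R₀ := by
    rintro _ ⟨γ, hγ, k, hk, rfl⟩
    by_cases h : k = 0
    · right
      subst h
      rw [mul_assoc, rightFrame, ← translation_add, add_neg_cancel, translation_zero, mul_one]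
      exact hγ
    · left
      rw [mul_assoc, ← deltaRot_four_zero]
      exact mul_mem_rightFrames hγ (rightFrame_mul_deltaRot_mem hk _ (Or.inl h))
  cyc_T _ := mul_cyc_mem_leftFrames
  -- Only the unturned frame (j = 0) of the tile i = 0 has a type 4 tile across [0, ∞].
  T₂ := by
    rintro _ ⟨γ, hγ, i, hi, j, hj, rfl⟩
    interval_cases j
    · rcases i with _ | i
      · right
        simpa [translation_zero] using hγ
      · left
        rw [pow_zero, mul_one, mul_assoc, rotB₂_eq, ← mul_assoc (translation _), ← translation_add]
        refine mul_mem_leftFrames hγ ?_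
        convert translation_mul_cyc_pow_mem (show i < m + 1 by omega) 1 using 2
        · congr 1
          push_cast
          ring
        · rw [pow_one]
    · left
      rw [mul_assoc, mul_assoc, pow_one, cyc_mul_rotB₂, ← mul_assoc (translation _)]
      exact mul_mem_leftFrames hγ (mul_cyc_mem_leftFrames (translation_mul_rotA₀_mem hi))
    · left
      rw [mul_assoc, mul_assoc, cyc_sq_mul_rotB₂, ← mul_assoc (translation _), pow_two,
        ← mul_assoc (translation _ * _)]
      exact mul_mem_leftFrames hγ
        (mul_cyc_mem_leftFrames (mul_cyc_mem_leftFrames (translation_mul_rotB₁_mem hi)))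
  T₀_sub γ hγ := ⟨γ, hγ, 0, by omega, 0, by omega, by simp [translation_zero]⟩
  T₀_R γ hγ := ⟨γ, hγ, 0, by omega, rfl⟩
  T₀_0 γ hγ := mul_mem_leftFrames hγ (by
    simpa [translation_zero] using translation_mul_rotA₀_mem (n := n) (show 0 < m + 1 by omega))
  T₀_1 γ hγ := mul_mem_leftFrames hγ (by
    simpa [translation_zero] using translation_mul_rotB₁_mem (n := n) (show 0 < m + 1 by omega))

/-! ### The translations in the conjugates of the jigsaw group -/

/-- Pigeonhole: infinitely many translates `g * translation t` are frames, while the frames form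
finitely many orbits under the group. Two translates in one orbit differ by an element of the group.
-/
theorem exists_mul_translation_eq (m n : ℕ) (hn : 1 ≤ n) {g : SL(2, ℝ)}
    (hg : g ∈ rightFrames (jigsaw (m + 1) n (by omega)) n ∪
      leftFrames (jigsaw (m + 1) n (by omega)) (m + 1)) :
    ∃ P : ℕ, 0 < P ∧ ∃ γ ∈ groupLift (jigsaw (m + 1) n (by omega)),
      g * translation P = γ * g := by
  set J := jigsaw (m + 1) n (by omega)
  have S : IsFrameSystem (orbitInfty J) (rightFrames J n) (leftFrames J (m + 1)) (groupLift J) :=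
    isFrameSystem_jigsaw m n hn
  set A : Set ℕ := {t | g * translation t ∈ rightFrames J n ∪ leftFrames J (m + 1)} with hA
  have h0 : 0 ∈ A := by simpa [hA, translation_zero] using hg
  have hinf : A.Infinite := by
    refine Set.infinite_of_forall_exists_gt fun N => ?_
    induction N with
    | zero =>
      obtain ⟨t, ht, h⟩ := S.exists_mul_translation_mem hg
      exact ⟨t, h, ht⟩
    | succ N ih =>
      obtain ⟨s, hs, hNs⟩ := ih
      obtain ⟨t, ht, h⟩ := S.exists_mul_translation_mem hs
      refine ⟨s + t, ?_, by omega⟩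
      rw [mul_assoc, ← translation_add] at h
      simpa [hA] using h
  let rep : Fin n ⊕ Fin (m + 1) × Fin 3 → SL(2, ℝ) :=
    Sum.elim (fun k => rightFrame k) fun x => translation (-((x.1 : ℕ) : ℝ)) * cyc ^ (x.2 : ℕ)
  have hrep (t : A) : ∃ x, ∃ γ ∈ groupLift J, g * translation (t : ℕ) = γ * rep x := by
    obtain ⟨t, ⟨γ, hγ, k, hk, e⟩ | ⟨γ, hγ, i, hi, j, hj, e⟩⟩ := t
    · exact ⟨Sum.inl ⟨k, hk⟩, γ, hγ, e⟩
    · exact ⟨Sum.inr (⟨i, hi⟩, ⟨j, hj⟩), γ, hγ, e⟩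
  choose f γ hγ e using hrep
  have := hinf.to_subtype
  obtain ⟨s, t, hst, hf⟩ := Finite.exists_ne_map_eq_of_infinite f
  have key {s t : A} (h : (s : ℕ) < t) (hf : f s = f t) : ∃ P : ℕ, 0 < P ∧
      ∃ γ ∈ groupLift J, g * translation P = γ * g := by
    refine ⟨t - s, by omega, γ t * (γ s)⁻¹, mul_mem (hγ t) (inv_mem (hγ s)), ?_⟩
    rw [← mul_left_inj (translation (s : ℕ)), mul_assoc, ← translation_add, mul_assoc _ g, e s,
      mul_assoc, inv_mul_cancel_left, hf, ← e t, Nat.cast_sub h.le, sub_add_cancel]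
  rcases lt_or_gt_of_ne (fun h => hst (Subtype.ext h) : (s : ℕ) ≠ t) with h | h
  · exact key h hf
  · exact key h hf.symm

theorem coe_mem_orbitInfty (m n : ℕ) (hn : 1 ≤ n) (x : ℚ) :
    ((x : ℝ) : OnePoint ℝ) ∈ orbitInfty (jigsaw (m + 1) n (by omega)) := by
  have S := isFrameSystem_jigsaw m n hn
  have h := S.reaches (fun g hg => by
    obtain ⟨P, hP, γ, hγ, e⟩ := exists_mul_translation_eq m n hn hg
    refine ⟨P, hP, fun x hx => ?_⟩
    rw [e, onBoundary_mul] at hx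
    have h := onBoundary_mem_orbitInfty (inv_mem hγ) hx
    rwa [← onBoundary_mul, inv_mul_cancel, onBoundary_one] at h) x.den 1
    (Or.inr (S.T₀_sub (one_mem _))) x.num x.den (by simp)
  rw [Reaches, onBoundary_one, ofHomogeneous, if_neg (by simp)] at h
  convert h using 2
  rw [Rat.cast_def]
  simp

/-! ### Rationality -/

/-- The real matrices of determinant one that are proportional to a rational matrix. -/
def rationalSubgroup : Subgroup SL(2, ℝ) where
  carrier := {g | ∃ l : ℝ, l ≠ 0 ∧ ∀ i j, ∃ x : ℚ, g i j = l * x}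
  one_mem' := ⟨1, one_ne_zero, fun i j => ⟨(1 : Matrix (Fin 2) (Fin 2) ℚ) i j, by
    fin_cases i <;> fin_cases j <;> simp⟩⟩
  mul_mem' := by
    rintro g h ⟨l, hl, hg⟩ ⟨k, hk, hh⟩
    choose x hx using hg
    choose y hy using hh
    refine ⟨l * k, mul_ne_zero hl hk, fun i j => ⟨x i 0 * y 0 j + x i 1 * y 1 j, ?_⟩⟩
    rw [Matrix.SpecialLinearGroup.coe_mul, Matrix.mul_apply, Fin.sum_univ_two, hx, hx, hy, hy]
    push_cast
    ring
  inv_mem' := by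
    rintro g ⟨l, hl, hg⟩
    choose x hx using hg
    refine ⟨l, hl, fun i j => ?_⟩
    rw [Matrix.SpecialLinearGroup.coe_inv, Matrix.adjugate_fin_two]
    fin_cases i <;> fin_cases j
    · exact ⟨x 1 1, by simp [hx]⟩
    · exact ⟨-x 0 1, by simp [hx]⟩
    · exact ⟨-x 1 0, by simp [hx]⟩
    · exact ⟨x 0 0, by simp [hx]⟩

theorem mem_rationalSubgroup {g : SL(2, ℝ)} (a b c d : ℚ) (h : g.1 = !![(a : ℝ), b; c, d]) :
    g ∈ rationalSubgroup := by
  refine ⟨1, one_ne_zero, fun i j => ⟨!![a, b; c, d] i j, ?_⟩⟩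
  rw [h]
  fin_cases i <;> fin_cases j <;> simp

/-- Central elements are scalar matrices, absorbed by the factor l. -/
theorem center_le_rationalSubgroup : Subgroup.center SL(2, ℝ) ≤ rationalSubgroup := by
  intro g hg
  obtain ⟨r, hr, h⟩ := Matrix.SpecialLinearGroup.mem_center_iff.1 hg
  refine ⟨r, by rintro rfl; simp at hr, fun i j => ⟨(1 : Matrix (Fin 2) (Fin 2) ℚ) i j, ?_⟩⟩
  rw [← h]
  fin_cases i <;> fin_cases j <;> simp

theorem deltaRot_four_mem (i : Fin 3) : deltaRot 4 i ∈ rationalSubgroup := by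
  fin_cases i
  · exact mem_rationalSubgroup (-1) (-2) 1 1 (by simp [deltaRot_four_zero, rotA₀])
  · exact mem_rationalSubgroup (-2) (-2) (5 / 2) 2 (by simp [deltaRot_four_one, rotA₁])
  · exact mem_rationalSubgroup 0 (-2) (1 / 2) 0 (by simp [deltaRot_four_two, rotA₂])

theorem deltaRot_one_two : deltaRot 1 2 = rotB₂ := by
  apply Subtype.ext
  refine (rotMatrix_mk _ _ _).trans ?_
  norm_num [rotB₂]

theorem deltaRot_one_mem (i : Fin 3) : deltaRot 1 i ∈ rationalSubgroup := by
  fin_cases i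
  · exact mem_rationalSubgroup (-1) (-2) 1 1 (by simp [deltaRot_one_zero, rotA₀])
  · exact mem_rationalSubgroup (-1) (-1) 2 1 (by simp [deltaRot_one_one, rotB₁])
  · exact mem_rationalSubgroup 0 (-1) 1 0 (by simp [deltaRot_one_two, rotB₂])

theorem rightFrame_mem_rationalSubgroup (k : ℕ) : rightFrame k ∈ rationalSubgroup := by
  induction k with
  | zero => exact mem_rationalSubgroup 1 1 0 1 (by simp [rightFrame, translation])
  | succ k ih => exact mul_mem ih (deltaRot_four_mem _)

theorem rotMatrix_mark_mem {m n : ℕ} {T : Tile} (hT : T ∈ tilesOf m n) (i : Fin 3) :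
    rotMatrix (T.side i).mark ∈ rationalSubgroup := by
  rcases hT with ⟨j, -, rfl⟩ | ⟨k, -, rfl⟩
  · have ht : translation (-(j : ℝ)) ∈ rationalSubgroup :=
      mem_rationalSubgroup 1 (-j) 0 1 (by simp [translation])
    rw [leftTile, ← Subgroup.mul_mem_cancel_right _ ht, rotMatrix_map_mark]
    exact mul_mem ht (deltaRot_one_mem i)
  · have ht := rightFrame_mem_rationalSubgroup k
    rw [rightTile_eq, ← Subgroup.mul_mem_cancel_right _ ht, rotMatrix_map_mark]
    exact mul_mem ht (deltaRot_four_mem i)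

theorem groupLift_le_rationalSubgroup (m n : ℕ) (hm : 1 ≤ m) :
    groupLift (jigsaw m n hm) ≤ rationalSubgroup := by
  have h : (jigsaw m n hm).group ≤
      rationalSubgroup.map (QuotientGroup.mk' (Subgroup.center SL(2, ℝ))) := by
    refine (Subgroup.closure_le _).2 ?_
    rintro _ ⟨s, ⟨⟨T, hT, i, rfl⟩, -⟩, rfl⟩
    exact ⟨_, rotMatrix_mark_mem hT i, rfl⟩
  -- Pulling the image back to SL(2, ℝ) adds only the kernel, that is, the centre.
  refine (Subgroup.comap_mono h).trans ?_
  rw [Subgroup.comap_map_eq, QuotientGroup.ker_mk']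
  exact sup_le le_rfl center_le_rationalSubgroup

end Jigsaw

end

/-! ### The set of cusps -/

theorem mainTheorem2 (m n : ℕ) (hm : 1 ≤ m) (hn : 1 ≤ n) :
    Jigsaw.cuspSet (Jigsaw.jigsaw m n hm).group =
      insert OnePoint.infty (Set.range fun q : ℚ => ((q : ℝ) : OnePoint ℝ)) := by
  obtain ⟨m, rfl⟩ := Nat.exists_eq_add_of_le' hm
  apply Set.Subset.antisymm
  · rintro c ⟨_, ⟨g, hg, rfl⟩, hp, hc⟩
    obtain ⟨l, hl, hx⟩ := Jigsaw.groupLift_le_rationalSubgroup (m + 1) n hm hg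
    choose x hx using hx
    -- A parabolic element fixes a single point, ∞ or (a - d)/(2c); the common factor l cancels in
    -- the quotient.
    rw [hp.smul_eq_self_iff.1 hc, Matrix.GeneralLinearGroup.parabolicFixedPoint]
    split_ifs with h
    · exact Or.inl rfl
    · refine Or.inr ⟨(x 0 0 - x 1 1) / (2 * x 1 0), congrArg _ ?_⟩
      have e (i j : Fin 2) : (Matrix.SpecialLinearGroup.toGL g) i j = l * x i j := hx i j
      rw [e, e, e]
      push_cast
      rw [← mul_sub, mul_left_comm, mul_div_mul_left _ _ hl]
  · have S := Jigsaw.isFrameSystem_jigsaw m n hn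
    -- For the frame 1 the period is a nontrivial translation in the group itself, so ∞ is a cusp.
    obtain ⟨P, hP, γ, hγ, e⟩ := Jigsaw.exists_mul_translation_eq m n hn
      (Or.inr (S.T₀_sub (one_mem _)))
    rw [one_mul, mul_one] at e
    have hP' : (P : ℝ) ≠ 0 := by exact_mod_cast hP.ne'
    have hc : ∞ ∈ Jigsaw.cuspSet (Jigsaw.jigsaw (m + 1) n hm).group := by
      refine ⟨_, Subgroup.mem_map_of_mem _ hγ, ?_, ?_⟩
      · subst e
        exact (Matrix.GeneralLinearGroup.isParabolic_iff_of_upperTriangular rfl).2 ⟨rfl, hP'⟩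
      · subst e
        exact Jigsaw.translation_infty _
    have key : Jigsaw.orbitInfty (Jigsaw.jigsaw (m + 1) n hm) ⊆
        Jigsaw.cuspSet (Jigsaw.jigsaw (m + 1) n hm).group := by
      rintro _ ⟨δ, hδ, rfl⟩
      exact IsCusp.smul_of_mem hc (Subgroup.mem_map_of_mem _ hδ)
    rintro _ (rfl | ⟨x, rfl⟩)
    · exact key (Jigsaw.infty_mem_orbitInfty _)
    · exact key (Jigsaw.coe_mem_orbitInfty m n hn x)
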